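/- Let $\mathcal H$ be a complex Hilbert space and let $\mathcal F=\mathbb C\oplus\mathcal H\oplus(\mathcal H\wedge\mathcal H)\oplus\cdots$ be the fermion Fock space over $\mathcal H$, with vacuum vector $\Omega$, creators $a^\dagger_h$ and annihilators $a_h=(a^\dagger_h)^*$ ($h\in\mathcal H$), so that $a^\dagger_g a_h+a_h a^\dagger_g=\langle h|g\rangle I$. Let $N=\sum_j a^\dagger_{e_j}a_{e_j}$ be the number operator, where $(e_j)$ is any orthonormal basis of $\mathcal H$. Let $\Delta$ be a density operator on $\mathcal F$ (a positive operator of trace $1$) such that $\Delta N=N\Delta$ (that is, $\Delta$ maps the domain of $N$ into itself, and $N\Delta x=\Delta N x$ for every $x$ in that domain) and $\mathrm{Tr}(\Delta N)<\infty$. Let $\gamma_\Delta$ be the operator on $\mathcal H$ determined by $\langle h|\gamma_\Delta g\rangle=\mathrm{Tr}(\Delta a^\dagger_g a_h)$ for all $g,h\in\mathcal H$. Then $\gamma_\Delta$ has a finite or infinite list $p_1,p_2,\ldots$ of positive eigenvalues, repeated according to multiplicity, with orthonormal eigenvectors $f_1,f_2,\ldots$ such that $\gamma_\Delta$ vanishes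 on the orthogonal complement of $\{f_1,f_2,\ldots\}$. For any such list, let $$\Gamma_{\gamma_\Delta}=\sum_{\mathbf s}p(\mathbf s)\,|a^\dagger_{\mathbf s}\Omega\rangle\langle a^\dagger_{\mathbf s}\Omega|,\qquad p(\mathbf s)=\prod_{i\in\mathbf s}p_i\prod_{j\notin\mathbf s}(1-p_j),$$ be the density operator of the free state with $1$-particle statistical operator $\gamma_\Delta$. Here $\mathbf s=\{s_1<\cdots<s_n\}$ ranges over the finite sets of indices, and $a^\dagger_{\mathbf s}=a^\dagger_{f_{s_n}}\cdots a^\dagger_{f_{s_1}}$. If $$-\sum_j p_j\log p_j-\sum_j(1-p_j)\log(1-p_j)<\infty ,$$ then $$S(\Delta\,|\,\Gamma_{\gamma_\Delta})=-\sum_j p_j\log p_j-\sum_j(1-p_j)\log(1-p_j)-S(\Delta),$$ and in particular both entropies are finite. Here $0\log 0=0$, and $S(X)=-\mathrm{Tr}(X\log X)\in[0,\infty]$ is the von Neumann entropy. The relative entropy $S(X|Y)=\mathrm{Tr}(X(\log X-\log Y))\in[0,\infty]$ of two density operators is $+\infty$ unless $\ker Y\subseteq\ker X$; if $\ker Y\subseteq\ker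 X$, it is $$S(X|Y)=\sum_{j,k}|\langle\phi_j,\psi_k\rangle|^2\,(x_j\log x_j-x_j\log y_k+y_k-x_j),$$ where $(\phi_j)$ and $(\psi_k)$ are orthonormal eigenbases of $X$ and $Y$ with eigenvalues $x_j$ and $y_k$. The left-hand side $S(\Delta|\Gamma_{\gamma_\Delta})$ is the nonfreeness of $\Delta$. -/

import Mathlib

open scoped InnerProductSpace
noncomputable section
namespace Fermion

/-- The complex conjugate of a complex algebra `A`: the same ring, on which the scalar `c` acts as
`conj c` acts on `A`. -/
def ConjAlgebra (A : Type*) : Type _ := A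

instance {A : Type*} [Ring A] : Ring (ConjAlgebra A) := inferInstanceAs (Ring A)

/-- The identity map from `A` to its complex conjugate. -/
def toConj {A : Type*} [Ring A] : A ≃+* ConjAlgebra A := RingEquiv.refl A

instance {A : Type*} [Ring A] [Algebra ℂ A] : Algebra ℂ (ConjAlgebra A) :=
  RingHom.toAlgebra' (toConj.toRingHom.comp ((algebraMap ℂ A).comp (starRingEnd ℂ)))
    (fun c x => Algebra.commutes (A := A) (starRingEnd ℂ c) x)

theorem algebraMap_conj {A : Type*} [Ring A] [Algebra ℂ A] (c : ℂ) :
    algebraMap ℂ (ConjAlgebra A) c = toConj (algebraMap ℂ A (starRingEnd ℂ c)) := rfl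

theorem smul_conj {A : Type*} [Ring A] [Algebra ℂ A] (c : ℂ) (a : A) :
    c • toConj a = toConj (starRingEnd ℂ c • a) := by
  rw [Algebra.smul_def, Algebra.smul_def, algebraMap_conj, map_mul]

variable {H : Type*} [NormedAddCommGroup H] [InnerProductSpace ℂ H]

/-- Interior product (contraction) with `h` on the exterior algebra of `H`. -/
def contract (h : H) : Module.End ℂ (ExteriorAlgebra ℂ H) :=
  CliffordAlgebra.contractLeft (Q := (0 : QuadraticForm ℂ H)) (innerSL ℂ h).toLinearMap

theorem contract_ι_mul (h g : H) (x : ExteriorAlgebra ℂ H) :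
    contract h (ExteriorAlgebra.ι ℂ g * x) =
      ⟪h, g⟫_ℂ • x - ExteriorAlgebra.ι ℂ g * contract h x :=
  CliffordAlgebra.contractLeft_ι_mul (Q := (0 : QuadraticForm ℂ H)) _ _ _

theorem contract_algebraMap (h : H) (c : ℂ) :
    contract h (algebraMap ℂ (ExteriorAlgebra ℂ H) c) = 0 :=
  CliffordAlgebra.contractLeft_algebraMap (Q := (0 : QuadraticForm ℂ H)) _ _

theorem contract_add (g h : H) : contract (g + h) = contract g + contract h := by
  simp [contract]

theorem contract_smul (c : ℂ) (h : H) : contract (c • h) = starRingEnd ℂ c • contract h := by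
  refine LinearMap.ext fun x => ?_
  simp [contract]

/-- The conjugate-linear algebra map that sends `v₁ ∧ ⋯ ∧ vₙ` to the contraction with `v₁`,
followed by the contraction with `v₂`, and so on. -/
def contractHom : ExteriorAlgebra ℂ H →ₐ[ℂ]
    ConjAlgebra (Module.End ℂ (ExteriorAlgebra ℂ H))ᵐᵒᵖ :=
  ExteriorAlgebra.lift ℂ ⟨
    { toFun := fun h => toConj (MulOpposite.op (contract h))
      map_add' := fun g h => by rw [contract_add, MulOpposite.op_add, map_add]
      map_smul' := fun c h => by
        rw [contract_smul, MulOpposite.op_smul, RingHom.id_apply, smul_conj] },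
    fun h => by
      change toConj _ * toConj _ = 0
      rw [← map_mul, ← MulOpposite.op_mul]
      have : contract h * contract h = 0 := LinearMap.ext fun x =>
        CliffordAlgebra.contractLeft_contractLeft (Q := (0 : QuadraticForm ℂ H)) _ x
      rw [this, MulOpposite.op_zero, map_zero]⟩

/-- The sesquilinear form on the exterior algebra, conjugate linear in the first variable, with
`⟨v₁ ∧ ⋯ ∧ vₙ, w₁ ∧ ⋯ ∧ wₘ⟩ = det ⟨vᵢ, wⱼ⟩` if `m = n`, and `0` otherwise: contract `y` with the
factors of `x` in turn and take the component of degree `0`. -/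
def wedgeInner (x y : ExteriorAlgebra ℂ H) : ℂ :=
  ExteriorAlgebra.algebraMapInv ((MulOpposite.unop (toConj.symm (contractHom x))) y)

theorem wedgeInner_ι_mul (h : H) (x y : ExteriorAlgebra ℂ H) :
    wedgeInner (ExteriorAlgebra.ι ℂ h * x) y = wedgeInner x (contract h y) := by
  have : contractHom (ExteriorAlgebra.ι ℂ h) = toConj (MulOpposite.op (contract h)) :=
    ExteriorAlgebra.lift_ι_apply _ _ _ _
  simp only [wedgeInner, map_mul, this, RingEquiv.symm_apply_apply, MulOpposite.unop_mul,
    MulOpposite.unop_op, Module.End.mul_apply]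

theorem wedgeInner_algebraMap (c : ℂ) (y : ExteriorAlgebra ℂ H) :
    wedgeInner (algebraMap ℂ _ c) y =
      starRingEnd ℂ c * ExteriorAlgebra.algebraMapInv y := by
  simp [wedgeInner, AlgHom.commutes, algebraMap_conj]

theorem wedgeInner_add_left (x x' y : ExteriorAlgebra ℂ H) :
    wedgeInner (x + x') y = wedgeInner x y + wedgeInner x' y := by
  simp [wedgeInner]

theorem wedgeInner_add_right (x y y' : ExteriorAlgebra ℂ H) :
    wedgeInner x (y + y') = wedgeInner x y + wedgeInner x y' := by
  simp [wedgeInner]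

theorem wedgeInner_neg_right (x y : ExteriorAlgebra ℂ H) :
    wedgeInner x (-y) = - wedgeInner x y := by
  simp [wedgeInner]

theorem wedgeInner_smul_right (c : ℂ) (x y : ExteriorAlgebra ℂ H) :
    wedgeInner x (c • y) = c * wedgeInner x y := by
  simp [wedgeInner]

theorem wedgeInner_smul_left (c : ℂ) (x y : ExteriorAlgebra ℂ H) :
    wedgeInner (c • x) y = starRingEnd ℂ c * wedgeInner x y := by
  rw [Algebra.smul_def]
  simp [wedgeInner, AlgHom.commutes, algebraMap_conj]

theorem algebraMapInv_ι_mul (h : H) (x : ExteriorAlgebra ℂ H) :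
    ExteriorAlgebra.algebraMapInv (ExteriorAlgebra.ι ℂ h * x) = 0 := by
  simp [ExteriorAlgebra.algebraMapInv]

theorem wedgeInner_contract (h : H) (y : ExteriorAlgebra ℂ H) : ∀ x,
    wedgeInner (contract h y) x = wedgeInner y (ExteriorAlgebra.ι ℂ h * x) := by
  induction y using CliffordAlgebra.left_induction with
  | algebraMap c =>
    intro x
    have h1 := contract_algebraMap h c
    have h2 := wedgeInner_algebraMap c (ExteriorAlgebra.ι ℂ h * x)
    rw [algebraMapInv_ι_mul, mul_zero] at h2
    have h3 : wedgeInner (0 : ExteriorAlgebra ℂ H) x = 0 := by simp [wedgeInner]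
    exact (congrArg (wedgeInner · x) h1).trans (h3.trans h2.symm)
  | add y y' hy hy' =>
    intro x
    rw [map_add, wedgeInner_add_left, wedgeInner_add_left, hy, hy']
  | ι_mul y g hy =>
    intro x
    have e1 := contract_ι_mul h g y
    have e2 := wedgeInner_ι_mul g y (ExteriorAlgebra.ι ℂ h * x)
    refine (congrArg (wedgeInner · x) e1).trans (Eq.trans ?_ e2.symm)
    simp only [sub_eq_add_neg, contract_ι_mul, wedgeInner_add_left, wedgeInner_add_right,
      wedgeInner_neg_right, wedgeInner_smul_right, ← neg_one_smul ℂ (ExteriorAlgebra.ι ℂ g * _),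
      wedgeInner_smul_left, wedgeInner_ι_mul, hy]
    simp

theorem wedgeInner_symm (x : ExteriorAlgebra ℂ H) : ∀ y,
    starRingEnd ℂ (wedgeInner y x) = wedgeInner x y := by
  induction x using CliffordAlgebra.left_induction with
  | algebraMap c =>
    intro y
    refine Eq.trans ?_ (wedgeInner_algebraMap c y).symm
    induction y using CliffordAlgebra.left_induction with
    | algebraMap d =>
      refine (congrArg (starRingEnd ℂ) (wedgeInner_algebraMap d (algebraMap ℂ _ c))).trans ?_
      have h1 := ExteriorAlgebra.algebraMap_leftInverse (R := ℂ) H c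
      have h2 := ExteriorAlgebra.algebraMap_leftInverse (R := ℂ) H d
      rw [h1]
      refine Eq.trans ?_ (congrArg (starRingEnd ℂ c * ·) h2.symm)
      simp [mul_comm]
    | add y y' hy hy' => rw [wedgeInner_add_left, map_add, hy, hy', map_add, mul_add]
    | ι_mul y g hy =>
      have e1 := wedgeInner_ι_mul g y (algebraMap ℂ _ c)
      rw [contract_algebraMap] at e1
      refine (congrArg (starRingEnd ℂ) e1).trans ?_
      refine Eq.trans ?_ (congrArg (starRingEnd ℂ c * ·) (algebraMapInv_ι_mul g y).symm)
      simp [wedgeInner]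
  | add x x' hx hx' =>
    intro y
    rw [wedgeInner_add_left, wedgeInner_add_right, map_add, hx, hx']
  | ι_mul x g hx =>
    intro y
    exact ((congrArg (starRingEnd ℂ) (wedgeInner_contract g y x).symm).trans
      (hx _)).trans (wedgeInner_ι_mul g x y).symm

/-- The subspace of the exterior algebra spanned by the wedge products of members of a list. -/
def wedgeSpan : List H → Submodule ℂ (ExteriorAlgebra ℂ H)
  | [] => Submodule.span ℂ {1}
  | h :: l => wedgeSpan l ⊔ (wedgeSpan l).map (LinearMap.mulLeft ℂ (ExteriorAlgebra.ι ℂ h))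

theorem mem_wedgeSpan_cons {h : H} {l : List H} {x : ExteriorAlgebra ℂ H} :
    x ∈ wedgeSpan (h :: l) ↔
      ∃ y ∈ wedgeSpan l, ∃ z ∈ wedgeSpan l, x = y + ExteriorAlgebra.ι ℂ h * z := by
  simp only [wedgeSpan, Submodule.mem_sup, Submodule.mem_map, LinearMap.mulLeft_apply]
  constructor
  · rintro ⟨y, hy, _, ⟨z, hz, rfl⟩, rfl⟩
    exact ⟨y, hy, z, hz, rfl⟩
  · rintro ⟨y, hy, z, hz, rfl⟩
    exact ⟨y, hy, _, ⟨z, hz, rfl⟩, rfl⟩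

theorem one_mem_wedgeSpan (l : List H) : (1 : ExteriorAlgebra ℂ H) ∈ wedgeSpan l := by
  induction l with
  | nil => exact Submodule.mem_span_singleton_self _
  | cons h l ih => exact (le_sup_left : wedgeSpan l ≤ wedgeSpan (h :: l)) ih

theorem ι_mul_mem_wedgeSpan (l : List H) : ∀ g ∈ l, ∀ x ∈ wedgeSpan l,
    ExteriorAlgebra.ι ℂ g * x ∈ wedgeSpan l := by
  induction l with
  | nil => simp
  | cons h l ih =>
    intro g hg x hx
    rw [mem_wedgeSpan_cons] at hx ⊢
    obtain ⟨y, hy, z, hz, rfl⟩ := hx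
    rcases List.mem_cons.mp hg with rfl | hg
    · refine ⟨0, Submodule.zero_mem _, y, hy, ?_⟩
      rw [mul_add, ← mul_assoc, ExteriorAlgebra.ι_sq_zero, zero_mul, add_zero, zero_add]
    · refine ⟨_, ih g hg y hy, -(ExteriorAlgebra.ι ℂ g * z),
        Submodule.neg_mem _ (ih g hg z hz), ?_⟩
      have := ExteriorAlgebra.ι_add_mul_swap (R := ℂ) g h
      rw [mul_add, ← mul_assoc, eq_neg_of_add_eq_zero_left this, mul_neg, neg_mul, mul_assoc]

theorem contract_wedgeSpan (h : H) (l : List H) (hl : ∀ g ∈ l, ⟪h, g⟫_ℂ = 0) :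
    ∀ x ∈ wedgeSpan l, contract h x = 0 := by
  induction l with
  | nil =>
    intro x hx
    obtain ⟨c, rfl⟩ := Submodule.mem_span_singleton.mp hx
    rw [← Algebra.algebraMap_eq_smul_one]
    exact contract_algebraMap h c
  | cons g l ih =>
    intro x hx
    obtain ⟨y, hy, z, hz, rfl⟩ := mem_wedgeSpan_cons.mp hx
    have hl' : ∀ g ∈ l, ⟪h, g⟫_ℂ = 0 := fun k hk => hl k (List.mem_cons_of_mem _ hk)
    rw [map_add, contract_ι_mul, ih hl' y hy, ih hl' z hz, hl g List.mem_cons_self]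
    simp

theorem wedgeInner_self_wedgeSpan (l : List H) (h1 : ∀ g ∈ l, ⟪g, g⟫_ℂ = 1)
    (h2 : l.Pairwise fun g h => ⟪g, h⟫_ℂ = 0) :
    ∀ x ∈ wedgeSpan l, 0 ≤ (wedgeInner x x).re := by
  induction l with
  | nil =>
    intro x hx
    obtain ⟨c, rfl⟩ := Submodule.mem_span_singleton.mp hx
    rw [wedgeInner_smul_left, wedgeInner_smul_right]
    have : wedgeInner (1 : ExteriorAlgebra ℂ H) 1 = 1 := by simp [wedgeInner]
    rw [this, mul_one, mul_comm, Complex.mul_conj]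
    exact Complex.normSq_nonneg c
  | cons g l ih =>
    intro x hx
    obtain ⟨y, hy, z, hz, rfl⟩ := mem_wedgeSpan_cons.mp hx
    rw [List.pairwise_cons] at h2
    have ih' := ih (fun k hk => h1 k (List.mem_cons_of_mem _ hk)) h2.2
    have e1 : ∀ w, wedgeInner y (ExteriorAlgebra.ι ℂ g * w) = 0 := fun w => by
      rw [← wedgeInner_contract, contract_wedgeSpan g l h2.1 y hy]
      simp [wedgeInner]
    have e2 : wedgeInner (ExteriorAlgebra.ι ℂ g * z) y = 0 := by
      rw [← wedgeInner_symm, e1, map_zero]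
    have e3 : wedgeInner (ExteriorAlgebra.ι ℂ g * z) (ExteriorAlgebra.ι ℂ g * z)
        = wedgeInner z z := by
      rw [wedgeInner_ι_mul, contract_ι_mul, contract_wedgeSpan g l h2.1 z hz,
        h1 g List.mem_cons_self]
      simp
    rw [wedgeInner_add_left, wedgeInner_add_right, wedgeInner_add_right, e1, e2, e3]
    simpa using add_nonneg (ih' y hy) (ih' z hz)

theorem exists_finite_span (x : ExteriorAlgebra ℂ H) : ∃ W : Submodule ℂ H,
    FiniteDimensional ℂ W ∧ ∀ p : Submodule ℂ (ExteriorAlgebra ℂ H), 1 ∈ p →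
      (∀ w ∈ W, ∀ z ∈ p, ExteriorAlgebra.ι ℂ w * z ∈ p) → x ∈ p := by
  induction x using CliffordAlgebra.left_induction with
  | algebraMap c =>
    refine ⟨⊥, inferInstance, fun p hp _ => ?_⟩
    rw [Algebra.algebraMap_eq_smul_one]
    exact p.smul_mem c hp
  | add x y hx hy =>
    obtain ⟨V, hV, hx⟩ := hx
    obtain ⟨W, hW, hy⟩ := hy
    exact ⟨V ⊔ W, inferInstance, fun p hp hw => p.add_mem
      (hx p hp fun w h => hw w (Submodule.mem_sup_left h))
      (hy p hp fun w h => hw w (Submodule.mem_sup_right h))⟩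
  | ι_mul x g hx =>
    obtain ⟨V, hV, hx⟩ := hx
    exact ⟨V ⊔ Submodule.span ℂ {g}, inferInstance, fun p hp hw =>
      hw g (Submodule.mem_sup_right (Submodule.mem_span_singleton_self g)) _
      (hx p hp fun w h => hw w (Submodule.mem_sup_left h))⟩

theorem wedgeInner_self_nonneg (x : ExteriorAlgebra ℂ H) : 0 ≤ (wedgeInner x x).re := by
  obtain ⟨W, hW, hx⟩ := exists_finite_span x
  let b := stdOrthonormalBasis ℂ W
  have ho := b.orthonormal
  let l : List H := List.ofFn fun i => (b i : H)
  refine wedgeInner_self_wedgeSpan l ?_ ?_ x (hx _ (one_mem_wedgeSpan l) ?_)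
  · intro g hg
    obtain ⟨i, rfl⟩ := (List.mem_ofFn' _ _).mp hg
    have := inner_self_eq_norm_sq_to_K (𝕜 := ℂ) (b i : H)
    rw [this, show ‖(b i : H)‖ = 1 from ho.1 i]
    simp
  · rw [List.pairwise_ofFn]
    intro i j hij
    exact ho.2 hij.ne
  · intro w hw z hz
    have e := congrArg (W.subtype) (b.sum_repr ⟨w, hw⟩)
    rw [map_sum] at e
    have e' : w = ∑ i, b.repr ⟨w, hw⟩ i • (b i : H) := by simpa using e.symm
    rw [e', map_sum, Finset.sum_mul]
    refine Submodule.sum_mem _ fun i _ => ?_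
    rw [map_smul, smul_mul_assoc]
    exact Submodule.smul_mem _ _ (ι_mul_mem_wedgeSpan l _ ((List.mem_ofFn' _ _).mpr ⟨i, rfl⟩) z hz)

/-- The exterior algebra of `H` as a space with the inner product
`⟨v₁ ∧ ⋯ ∧ vₙ, w₁ ∧ ⋯ ∧ wₙ⟩ = det ⟨vᵢ, wⱼ⟩`, different degrees being orthogonal. -/
def PreFock (H : Type*) [NormedAddCommGroup H] [InnerProductSpace ℂ H] : Type _ :=
  ExteriorAlgebra ℂ H

instance : AddCommGroup (PreFock H) := inferInstanceAs (AddCommGroup (ExteriorAlgebra ℂ H))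
instance : Module ℂ (PreFock H) := inferInstanceAs (Module ℂ (ExteriorAlgebra ℂ H))

/-- The positive semidefinite Hermitian form on the exterior algebra. -/
@[reducible] def preFockCore (H : Type*) [NormedAddCommGroup H] [InnerProductSpace ℂ H] :
    PreInnerProductSpace.Core ℂ (PreFock H) where
  inner x y := wedgeInner (H := H) x y
  conj_inner_symm x y := wedgeInner_symm (H := H) x y
  re_inner_nonneg x := wedgeInner_self_nonneg (H := H) x
  add_left x y z := wedgeInner_add_left (H := H) x y z
  smul_left x y c := wedgeInner_smul_left (H := H) c x y

instance : SeminormedAddCommGroup (PreFock H) :=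
  letI := preFockCore H
  InnerProductSpace.Core.toSeminormedAddCommGroup (𝕜 := ℂ)

instance : InnerProductSpace ℂ (PreFock H) := InnerProductSpace.ofCore (preFockCore H)

/-- The identity map from the exterior algebra. -/
def toPreFock : ExteriorAlgebra ℂ H ≃ₗ[ℂ] PreFock H := LinearEquiv.refl ℂ (ExteriorAlgebra ℂ H)

theorem inner_toPreFock (x y : ExteriorAlgebra ℂ H) :
    ⟪toPreFock x, toPreFock y⟫_ℂ = wedgeInner x y := rfl

/-- Left multiplication by `h`: `v₁ ∧ ⋯ ∧ vₙ ↦ h ∧ v₁ ∧ ⋯ ∧ vₙ`. -/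
def preCreator (h : H) : PreFock H →ₗ[ℂ] PreFock H :=
  toPreFock.toLinearMap ∘ₗ LinearMap.mulLeft ℂ (ExteriorAlgebra.ι ℂ h) ∘ₗ
    toPreFock.symm.toLinearMap

theorem preCreator_apply (h : H) (x : ExteriorAlgebra ℂ H) :
    preCreator h (toPreFock x) = toPreFock (ExteriorAlgebra.ι ℂ h * x) := rfl

theorem norm_preCreator_le (h : H) (x : PreFock H) : ‖preCreator h x‖ ≤ ‖h‖ * ‖x‖ := by
  obtain ⟨x, rfl⟩ := toPreFock.surjective x
  refine le_of_sq_le_sq ?_ (by positivity)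
  have e1 : ⟪preCreator h (toPreFock x), preCreator h (toPreFock x)⟫_ℂ =
      ⟪h, h⟫_ℂ * ⟪toPreFock x, toPreFock x⟫_ℂ -
        ⟪toPreFock (contract h x), toPreFock (contract h x)⟫_ℂ := by
    rw [preCreator_apply, inner_toPreFock, inner_toPreFock, inner_toPreFock, wedgeInner_ι_mul,
      contract_ι_mul, sub_eq_add_neg, wedgeInner_add_right, wedgeInner_neg_right,
      wedgeInner_smul_right, ← wedgeInner_contract, ← sub_eq_add_neg]
  have e2 := congrArg Complex.re e1
  have n1 := inner_self_eq_norm_sq_to_K (𝕜 := ℂ) (preCreator h (toPreFock x))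
  have n2 := inner_self_eq_norm_sq_to_K (𝕜 := ℂ) h
  have n3 := inner_self_eq_norm_sq_to_K (𝕜 := ℂ) (toPreFock x)
  have n4 := inner_self_eq_norm_sq_to_K (𝕜 := ℂ) (toPreFock (contract h x))
  rw [n1, n2, n3, n4] at e2
  have e3 : ‖preCreator h (toPreFock x)‖ ^ 2 = ‖h‖ ^ 2 * ‖toPreFock x‖ ^ 2 - ‖(toPreFock (contract h x))‖ ^ 2 := by
    norm_cast at e2
  rw [e3, mul_pow]
  nlinarith [sq_nonneg ‖(toPreFock (contract h x))‖]

/-- Fermion Fock space `ℂ ⊕ H ⊕ (H ∧ H) ⊕ ⋯`, as a Hilbert space: the completion of the exterior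
algebra of `H`. -/
abbrev FockSpace (H : Type*) [NormedAddCommGroup H] [InnerProductSpace ℂ H] : Type _ :=
  UniformSpace.Completion (PreFock H)

/-- The vacuum vector. -/
def vacuum : FockSpace H := ((toPreFock 1 : PreFock H) : UniformSpace.Completion (PreFock H))

/-- The creator of `h`. -/
def creator (h : H) : FockSpace H →L[ℂ] FockSpace H :=
  ((preCreator h).mkContinuous ‖h‖ (norm_preCreator_le h)).completion

/-- The annihilator of `h`. -/
def annihilator (h : H) : FockSpace H →L[ℂ] FockSpace H := ContinuousLinearMap.adjoint (creator h)


/-- The contraction of a wedge product by Laplace expansion. -/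
theorem contract_ιMulti (h : H) : ∀ (n : ℕ) (v : Fin (n + 1) → H),
    contract h (ExteriorAlgebra.ιMulti ℂ (n + 1) v) =
      ∑ i : Fin (n + 1), ((-1) ^ (i : ℕ) * ⟪h, v i⟫_ℂ) •
        ExteriorAlgebra.ιMulti ℂ n (v ∘ i.succAbove)
  | 0, v => by
    rw [ExteriorAlgebra.ιMulti_succ_apply, contract_ι_mul]
    have := contract_algebraMap h 1
    rw [map_one] at this
    simp [this]
  | n + 1, v => by
    rw [ExteriorAlgebra.ιMulti_succ_apply, contract_ι_mul, contract_ιMulti h n,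
      Finset.mul_sum, Fin.sum_univ_succ (n := n + 1), sub_eq_add_neg, ← Finset.sum_neg_distrib]
    congr 1
    · simp [Matrix.vecTail, Function.comp_def]
    · refine Finset.sum_congr rfl fun i _ => ?_
      rw [ExteriorAlgebra.ιMulti_succ_apply (v ∘ _), mul_smul_comm, ← neg_smul]
      congr 1
      · simp [Matrix.vecTail, pow_succ]
      · have e1 : Matrix.vecTail (v ∘ i.succ.succAbove) = Matrix.vecTail v ∘ i.succAbove := by
          funext k
          simp [Matrix.vecTail]
        rw [e1]
        simp

/-- The inner product of two wedge products of `n` vectors is the Gram determinant. -/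
theorem wedgeInner_ιMulti : ∀ (n : ℕ) (v w : Fin n → H),
    wedgeInner (ExteriorAlgebra.ιMulti ℂ n v) (ExteriorAlgebra.ιMulti ℂ n w) =
      Matrix.det (Matrix.of fun i j => ⟪v i, w j⟫_ℂ)
  | 0, v, w => by simp [wedgeInner]
  | n + 1, v, w => by
    rw [ExteriorAlgebra.ιMulti_succ_apply, wedgeInner_ι_mul, contract_ιMulti, Matrix.det_succ_row_zero]
    have hsum : ∀ (x : ExteriorAlgebra ℂ H) (f : Fin (n + 1) → ExteriorAlgebra ℂ H),
        wedgeInner x (∑ i, f i) = ∑ i, wedgeInner x (f i) := fun x f => by simp [wedgeInner]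
    rw [hsum]
    refine Finset.sum_congr rfl fun i _ => ?_
    rw [wedgeInner_smul_right, wedgeInner_ιMulti n]
    rfl

section Operators

variable {E : Type*} [NormedAddCommGroup E] [InnerProductSpace ℂ E] [CompleteSpace E]

/-- The set of vectors of a reference orthonormal basis of a Hilbert space. -/
def onbSet (E : Type*) [NormedAddCommGroup E] [InnerProductSpace ℂ E] [CompleteSpace E] : Set E :=
  (exists_hilbertBasis ℂ E).choose

/-- A reference orthonormal basis of a Hilbert space. -/
def onb (E : Type*) [NormedAddCommGroup E] [InnerProductSpace ℂ E] [CompleteSpace E] :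
    HilbertBasis (onbSet E) ℂ E :=
  (exists_hilbertBasis ℂ E).choose_spec.choose

/-- The trace of a trace-class operator (its value does not depend on the orthonormal basis). -/
def trace (T : E →L[ℂ] E) : ℂ := ∑' u : onbSet E, ⟪onb E u, T (onb E u)⟫_ℂ

/-- The trace of a positive operator, in `[0, ∞]` (it does not depend on the orthonormal basis). -/
def posTrace (T : E →L[ℂ] E) : ENNReal :=
  ∑' u : onbSet E, ENNReal.ofReal (⟪onb E u, T (onb E u)⟫_ℂ).re

/-- A density operator: a positive operator of trace `1`. -/
structure IsDensityOperator (D : E →L[ℂ] E) : Prop where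
  isPositive : D.IsPositive
  posTrace_eq : posTrace D = 1

/-- The von Neumann entropy `-Tr (X log X)`, in `[0, ∞]`. The operator `-X log X` is formed by the
continuous functional calculus; it is positive when `X` is a density operator. -/
def entropy (X : E →L[ℂ] E) : ENNReal := posTrace (cfc Real.negMulLog X)

/-- The orthogonal projector on `ker (X - t)`: the spectral projector of the eigenvalue `t` of a
self-adjoint `X`, and `0` if `t` is not an eigenvalue. -/
def eigenprojector (X : E →L[ℂ] E) (t : ℝ) : E →L[ℂ] E :=
  (X - (t : ℂ) • ContinuousLinearMap.id ℂ E).ker.starProjection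

open Classical in
/-- The relative entropy `S(X|Y) = Tr (X (log X - log Y))` of two density operators, in `[0, ∞]`.
It is `∞` unless `ker Y ⊆ ker X`; if `ker Y ⊆ ker X`, then it is the sum of the nonnegative numbers
`|⟨φ, ψ⟩|² (x log x - x log y + y - x)` over the members `φ` (with eigenvalue `x`) of an orthonormal
eigenbasis of `X` and the members `ψ` (with eigenvalue `y`) of one of `Y`. For fixed `x` and `y` the
numbers `|⟨φ, ψ⟩|²` add up to `Tr (P Q P)`, where `P` and `Q` are the spectral projectors of `X` and
`Y` for `x` and `y`, so that no choice of eigenbases enters. -/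
def relEntropy (X Y : E →L[ℂ] E) : ENNReal :=
  if Y.ker ≤ X.ker then
    ∑' (x : ℝ) (y : ℝ),
      posTrace (eigenprojector X x * eigenprojector Y y * eigenprojector X x) *
        ENNReal.ofReal (x * Real.log x - x * Real.log y + y - x)
  else ⊤

end Operators

/-- The number operator `N = ∑ a†ⱼ aⱼ`, with `aⱼ` the annihilator of the `j`-th vector of an
orthonormal basis of `H`, as an unbounded operator on Fock space: its domain consists of the vectors
on which the sum converges. -/
def numberOperator {ι : Type*} (b : HilbertBasis ι ℂ H) : FockSpace H →ₗ.[ℂ] FockSpace H where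
  domain :=
    { carrier := {x | Summable fun j => creator (b j) (annihilator (b j) x)}
      add_mem' := fun {x y} hx hy => by
        simpa only [Set.mem_ofPred_eq, map_add] using Summable.add hx hy
      zero_mem' := by simp [summable_zero]
      smul_mem' := fun c x hx => by
        simpa only [Set.mem_ofPred_eq, map_smul] using Summable.const_smul c hx }
  toFun :=
    { toFun := fun x => ∑' j, creator (b j) (annihilator (b j) (x : FockSpace H))
      map_add' := fun x y => by
        simp only [Submodule.coe_add, map_add]
        exact Summable.tsum_add x.2 y.2
      map_smul' := fun c x => by
        simp only [Submodule.coe_smul, map_smul, RingHom.id_apply]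
        exact Summable.tsum_const_smul c x.2 }

/-- The class of density operators `Δ` on Fock space with `Δ N = N Δ` and `Tr (Δ N) < ∞`. As usual
for a bounded and an unbounded operator, commutation means that `Δ` maps the domain of `N` to itself
and `N Δ x = Δ N x` there. Then `Δ N` is a positive operator defined on the domain of `N`, and
`Tr (Δ N) < ∞` means that it extends to a positive operator of finite trace. -/
structure InClassD {ι : Type*} (b : HilbertBasis ι ℂ H) (D : FockSpace H →L[ℂ] FockSpace H) :
    Prop where
  isDensityOperator : IsDensityOperator D
  commutes : ∀ x : (numberOperator b).domain, ∃ hx : D x ∈ (numberOperator b).domain,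
    numberOperator b ⟨D x, hx⟩ = D (numberOperator b x)
  finite_mean : ∃ T : FockSpace H →L[ℂ] FockSpace H, T.IsPositive ∧ posTrace T < ⊤ ∧
    ∀ x : (numberOperator b).domain, T x = D (numberOperator b x)

open Classical in
/-- The `1`-particle statistical operator `γ` of a density operator `Δ`: the operator on `H` such
that `⟨h | γ g⟩ = Tr (Δ a†_g a_h)` for all `g` and `h` (there is exactly one). -/
def oneParticleOperator (D : FockSpace H →L[ℂ] FockSpace H) : H →L[ℂ] H :=
  if hex : ∃ G : H →L[ℂ] H, ∀ g h : H, ⟪h, G g⟫_ℂ = trace (D * (creator g * annihilator h)) then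
    hex.choose
  else 0

/-- A list of the positive eigenvalues of a Hermitian operator `G` with pure point spectrum, repeated
according to their multiplicities, together with corresponding orthonormal eigenvectors. The list may
be finite or infinite; it is indexed by a set of natural numbers. -/
structure EigenList (G : H →L[ℂ] H) where
  index : Set ℕ
  vec : index → H
  val : index → ℝ
  orthonormal : Orthonormal ℂ vec
  eigen : ∀ j, G (vec j) = (val j : ℂ) • vec j
  pos : ∀ j, 0 < val j
  complete : ∀ x : H, (∀ j, ⟪vec j, x⟫_ℂ = 0) → G x = 0

namespace EigenList

variable {G : H →L[ℂ] H} (L : EigenList G)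

/-- For a finite set `s = {s₁ < ⋯ < sₙ}` of indices, the vector `a†_{sₙ} ⋯ a†_{s₁} Ω`. -/
def slater (s : Finset L.index) : FockSpace H :=
  ((s.sort (· ≤ ·)).reverse.map fun j => creator (L.vec j)).prod vacuum

/-- `p(s) = ∏_{i ∈ s} pᵢ ∏_{j ∉ s} (1 - pⱼ)`. -/
def weight (s : Finset L.index) : ℝ :=
  (∏ i ∈ s, L.val i) * ∏' j : {j : L.index // j ∉ s}, (1 - L.val j)

/-- The density operator `∑ₛ p(s) |a†ₛ Ω⟩⟨a†ₛ Ω|` of the free state, the sum being over the finite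
sets of indices. -/
def freeDensity : FockSpace H →L[ℂ] FockSpace H :=
  ∑' s : Finset L.index, (L.weight s : ℂ) • InnerProductSpace.rankOne ℂ (L.slater s) (L.slater s)

/-- `-∑ pⱼ log pⱼ - ∑ (1 - pⱼ) log (1 - pⱼ)`, in `[0, ∞]`. -/
def freeEntropy : ENNReal :=
  ∑' j, ENNReal.ofReal (-(L.val j * Real.log (L.val j))) +
    ∑' j, ENNReal.ofReal (-((1 - L.val j) * Real.log (1 - L.val j)))

end EigenList

/-- The nonfreeness of `Δ`: its entropy relative to the free state with the same `1`-particle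
statistical operator. -/
def nonfreeness (D : FockSpace H →L[ℂ] FockSpace H) (L : EigenList (oneParticleOperator D)) :
    ENNReal :=
  relEntropy D L.freeDensity

end Fermion

end

/-! Diagonalise `Δ` with eigenvectors `φ k` and eigenvalues `x k`, and put `c k s = |⟨φ k, a†ₛ
Ω⟩|²`. The numbers `x k * c k s` form a joint probability distribution of `k` and the finite set
`s`, and `S(Δ|Γ) + S(Δ)` is the cross entropy `-Tr (Δ log Γ)`, the expectation of `-log p(s)`.
Because `p` is a product, `-log p(s)` is a sum over `j` of terms that depend only on whether `j ∈
s`. The expectation therefore sees only the marginals, whatever the correlations of the occupations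
under `Δ`. The probability of `j ∈ s` is `∑ₖ xₖ ‖a_{fⱼ} φₖ‖² = ⟨fⱼ|γ fⱼ⟩ = pⱼ`, so the expectation
is the free entropy. This is `tsum_neg_log_bernoulliWeight` combined with
`IsEigenbasis.tsum_overlap_mem`; the sum rule is `IsEigenbasis.nonfreeness_add_entropy`.

Two facts about supports are needed. If `h` is orthogonal to all `fⱼ`, then `0 = ⟨h|γ h⟩ = ∑ₖ xₖ
‖a_h φₖ‖²`; hence every `φ k` with `x k > 0` lies in the closed span of the vectors `a†ₛ Ω`, and the
joint distribution has total mass `1`. If `p(s) = 0`, then `pⱼ = 1` for some `j ∉ s`, and sets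
without `j` carry no mass; this gives `ker Γ ⊆ ker Δ`.

The eigenvalue list exists because `γ` is positive with the same trace as the extension of `Δ N`,
and a positive operator of finite trace is compact (`isCompactOperator_of_tsum_diag`). Sums of
entropies are handled in `[0, ∞]`, where they may be reordered freely, and the subtraction happens
only at the end. -/

noncomputable section
namespace Fermion

/-! ### Eigenbases of trace-class operators; trace, entropy and relative entropy computed in them -/

section Eigenbases

universe u

variable {E : Type u} [NormedAddCommGroup E] [InnerProductSpace ℂ E]
variable {κ κ' : Type*}

theorem ofReal_sq_norm {F : Type*} [SeminormedAddCommGroup F] (x : F) :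
    ENNReal.ofReal (‖x‖ ^ 2) = ‖x‖ₑ ^ 2 := by
  rw [ENNReal.ofReal_pow (norm_nonneg _), ofReal_norm]

theorem enorm_inner_symm {F : Type*} [SeminormedAddCommGroup F] [InnerProductSpace ℂ F] (x y : F) :
    ‖⟪x, y⟫_ℂ‖ₑ = ‖⟪y, x⟫_ℂ‖ₑ := by
  rw [← ofReal_norm, ← ofReal_norm, norm_inner_symm]

/-- Parseval's identity. -/
theorem tsum_enorm_inner_sq (e : HilbertBasis κ ℂ E) (u : E) :
    ∑' k, ‖⟪e k, u⟫_ℂ‖ₑ ^ 2 = ‖u‖ₑ ^ 2 := by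
  have h := (e.hasSum_inner_mul_inner u u).mapL Complex.reCLM
  have h1 : ∀ k, Complex.reCLM (⟪u, e k⟫_ℂ * ⟪e k, u⟫_ℂ) = ‖⟪e k, u⟫_ℂ‖ ^ 2 := fun k => by
    rw [← inner_conj_symm u, Complex.reCLM_apply, mul_comm, Complex.mul_conj,
      Complex.normSq_eq_norm_sq, Complex.ofReal_re]
  simp only [h1] at h
  have h2 : Complex.reCLM ⟪u, u⟫_ℂ = ‖u‖ ^ 2 := by
    rw [Complex.reCLM_apply]; exact inner_self_eq_norm_sq (𝕜 := ℂ) u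
  rw [h2] at h
  simp only [← ofReal_sq_norm]
  rw [← h.tsum_eq, ENNReal.ofReal_tsum_of_nonneg (fun _ => by positivity) h.summable]

theorem tsum_enorm_inner_sq' (e : HilbertBasis κ ℂ E) (u : E) :
    ∑' k, ‖⟪u, e k⟫_ℂ‖ₑ ^ 2 = ‖u‖ₑ ^ 2 := by
  simp only [enorm_inner_symm u, tsum_enorm_inner_sq]

/-- `X` is diagonal in the orthonormal basis `φ`, with the real eigenvalues `x`. -/
def IsEigenbasis (φ : HilbertBasis κ ℂ E) (X : E →L[ℂ] E) (x : κ → ℝ) : Prop :=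
  ∀ k, X (φ k) = (x k : ℂ) • φ k

variable {φ : HilbertBasis κ ℂ E} {X : E →L[ℂ] E} {x : κ → ℝ}

theorem IsEigenbasis.hasSum_apply (h : IsEigenbasis φ X x) (u : E) :
    HasSum (fun k => ((x k : ℂ) * ⟪φ k, u⟫_ℂ) • φ k) (X u) := by
  have := (φ.hasSum_repr u).mapL X
  simpa only [map_smul, h _, smul_smul, mul_comm, φ.repr_apply_apply] using this

theorem inner_eq_of_hasSum {e : HilbertBasis κ ℂ E} {c : κ → ℂ} {v : E}
    (h : HasSum (fun k => c k • e k) v) (k : κ) : ⟪e k, v⟫_ℂ = c k := by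
  classical
  have h1 := h.mapL (innerSL ℂ (e k))
  simp only [innerSL_apply_apply, inner_smul_right, orthonormal_iff_ite.mp e.orthonormal] at h1
  have h2 := hasSum_ite_eq k (c k)
  refine h1.unique ((congrArg (HasSum · _) (funext fun j => ?_)).mpr h2)
  by_cases hj : j = k
  · subst hj; simp
  · simp [hj, Ne.symm hj]

theorem IsEigenbasis.inner_apply (h : IsEigenbasis φ X x) (k : κ) (u : E) :
    ⟪φ k, X u⟫_ℂ = x k * ⟪φ k, u⟫_ℂ :=
  inner_eq_of_hasSum (h.hasSum_apply u) k

theorem IsEigenbasis.hasSum_inner (h : IsEigenbasis φ X x) (u : E) :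
    HasSum (fun k => (x k : ℂ) * (‖⟪φ k, u⟫_ℂ‖ ^ 2 : ℝ)) ⟪u, X u⟫_ℂ := by
  have h1 := (h.hasSum_apply u).mapL (innerSL ℂ u)
  simp only [innerSL_apply_apply, inner_smul_right] at h1
  refine (congrArg (HasSum · _) (funext fun k => ?_)).mpr h1
  rw [← inner_conj_symm u, mul_assoc, Complex.mul_conj, Complex.normSq_eq_norm_sq]

theorem IsEigenbasis.hasSum_re_inner (h : IsEigenbasis φ X x) (u : E) :
    HasSum (fun k => x k * ‖⟪φ k, u⟫_ℂ‖ ^ 2) (⟪u, X u⟫_ℂ).re := by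
  have h1 := (h.hasSum_inner u).mapL Complex.reCLM
  refine (congrArg (HasSum · _) (funext fun k => ?_)).mpr h1
  rw [← Complex.ofReal_mul]
  rfl

theorem IsEigenbasis.ofReal_re_inner (h : IsEigenbasis φ X x) (hx : ∀ k, 0 ≤ x k) (u : E) :
    ENNReal.ofReal (⟪u, X u⟫_ℂ).re = ∑' k, ENNReal.ofReal (x k) * ‖⟪φ k, u⟫_ℂ‖ₑ ^ 2 := by
  have h1 := h.hasSum_re_inner u
  rw [← h1.tsum_eq, ENNReal.ofReal_tsum_of_nonneg
    (fun k => mul_nonneg (hx k) (by positivity)) h1.summable]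
  exact tsum_congr fun k => by rw [ENNReal.ofReal_mul (hx k), ofReal_sq_norm]

theorem IsEigenbasis.nonneg (h : IsEigenbasis φ X x) (hX : X.IsPositive) (k : κ) : 0 ≤ x k := by
  have := hX.re_inner_nonneg_right (φ k)
  rw [h k, inner_smul_right, inner_self_eq_norm_sq_to_K, φ.orthonormal.1] at this
  simpa using this

/-- Expand the diagonal entries in `φ`, exchange the two nonnegative sums and apply Parseval. This
moves a trace from the reference basis to any other basis. -/
theorem IsEigenbasis.tsum_diag (h : IsEigenbasis φ X x) (hx : ∀ k, 0 ≤ x k)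
    (e : HilbertBasis κ' ℂ E) :
    ∑' u, ENNReal.ofReal (⟪e u, X (e u)⟫_ℂ).re = ∑' k, ENNReal.ofReal (x k) := by
  simp only [h.ofReal_re_inner hx]
  rw [ENNReal.tsum_comm]
  refine tsum_congr fun k => ?_
  rw [ENNReal.tsum_mul_left, tsum_enorm_inner_sq', ← ofReal_sq_norm, φ.orthonormal.1]
  simp

theorem isCompactOperator_rankOne (u v : E) :
    IsCompactOperator (InnerProductSpace.rankOne ℂ u v) := by
  have h := (isCompactOperator_of_locallyCompactSpace_rng
    (ContinuousLinearMap.toSpanSingleton ℂ u)).comp_clm (innerSL ℂ v)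
  refine (congrArg IsCompactOperator (funext fun y => ?_)).mp h
  simp

variable [CompleteSpace E]

theorem IsEigenbasis.posTrace_eq (h : IsEigenbasis φ X x) (hx : ∀ k, 0 ≤ x k) :
    posTrace X = ∑' k, ENNReal.ofReal (x k) := h.tsum_diag hx _

theorem exists_adjoint_mul_self {T : E →L[ℂ] E} (hT : T.IsPositive) :
    ∃ B : E →L[ℂ] E, T = ContinuousLinearMap.adjoint B * B :=
  CStarAlgebra.nonneg_iff_eq_star_mul_self.mp
    ((ContinuousLinearMap.nonneg_iff_isPositive T).mpr hT)

/-- Writing `T = B* B`, one has `‖T u‖² ≤ ‖B*‖² ‖B u‖²` and `‖B u‖² = ⟨u, T u⟩`. Finiteness of the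
trace thereby controls the sum of all `‖T (e u)‖²`. -/
theorem exists_enorm_apply_sq_le {T : E →L[ℂ] E} (hT : T.IsPositive) :
    ∃ C : NNReal, ∀ u, ‖T u‖ₑ ^ 2 ≤ C * ENNReal.ofReal (⟪u, T u⟫_ℂ).re := by
  obtain ⟨B, rfl⟩ := exists_adjoint_mul_self hT
  refine ⟨‖ContinuousLinearMap.adjoint B‖₊ ^ 2, fun u => ?_⟩
  have h1 : (⟪u, (ContinuousLinearMap.adjoint B * B) u⟫_ℂ).re = ‖B u‖ ^ 2 := by
    rw [mul_apply_eq_comp, ContinuousLinearMap.adjoint_inner_right]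
    exact inner_self_eq_norm_sq (𝕜 := ℂ) (B u)
  rw [h1, ofReal_sq_norm, ENNReal.coe_pow, ← mul_pow]
  gcongr
  exact (ContinuousLinearMap.adjoint B).le_opENorm (B u)

/-- A positive operator of finite trace, computed in any orthonormal basis, is compact. -/
theorem isCompactOperator_of_tsum_diag {T : E →L[ℂ] E} (hT : T.IsPositive)
    (e : HilbertBasis κ ℂ E) (h : ∑' u, ENNReal.ofReal (⟪e u, T (e u)⟫_ℂ).re ≠ ⊤) :
    IsCompactOperator T := by
  classical
  obtain ⟨C, hC⟩ := exists_enorm_apply_sq_le hT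
  -- By symmetry of `T`, this finite-rank operator is `T` followed by the projection onto the span
  -- of the `e u`, `u ∈ F`.
  let S : Finset κ → E →L[ℂ] E := fun F => ∑ u ∈ F, InnerProductSpace.rankOne ℂ (e u) (T (e u))
  have hS : ∀ F, IsCompactOperator (S F) := fun F =>
    Submodule.sum_mem (compactOperator (RingHom.id ℂ) E E)
      (fun u _ => isCompactOperator_rankOne (e u) (T (e u)))
  have hin : ∀ F u y, ⟪e u, (T - S F) y⟫_ℂ = if u ∈ F then 0 else ⟪T (e u), y⟫_ℂ := by
    intro F u y
    have h1 : ⟪e u, T y⟫_ℂ = ⟪T (e u), y⟫_ℂ := (hT.isSymmetric (e u) y).symm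
    simp only [S, sub_apply, sum_apply, inner_sub_right, h1,
      inner_sum, InnerProductSpace.rankOne_apply, inner_smul_right,
      orthonormal_iff_ite.mp e.orthonormal]
    simp
    split_ifs <;> simp
  -- Parseval and Cauchy–Schwarz bound the squared error by the sum of `‖T (e u)‖²` over `u ∉ F`,
  -- hence by a tail of the trace.
  have hb : ∀ F, ‖T - S F‖ₑ ^ 2 ≤ C * ∑' b : {u // u ∉ F},
      ENNReal.ofReal (⟪e b, T (e b)⟫_ℂ).re := by
    intro F
    set R := ∑' b : {u // u ∉ F}, ENNReal.ofReal (⟪e b, T (e b)⟫_ℂ).re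
    have hR : R ≠ ⊤ := ne_top_of_le_ne_top h (ENNReal.tsum_comp_le_tsum_of_injective
      Subtype.val_injective (fun u => ENNReal.ofReal (⟪e u, T (e u)⟫_ℂ).re))
    have hy : ∀ y, ‖(T - S F) y‖ₑ ^ 2 ≤ C * R * ‖y‖ₑ ^ 2 := by
      intro y
      rw [← tsum_enorm_inner_sq e]
      have hz : Function.support (fun u => ‖⟪e u, (T - S F) y⟫_ℂ‖ₑ ^ 2) ⊆
          Set.range (Subtype.val : {u // u ∉ F} → κ) := by
        intro u hu
        rw [Subtype.range_coe_subtype]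
        intro huF
        refine hu ?_
        simp only [hin, if_pos huF, enorm_zero, ne_eq, OfNat.ofNat_ne_zero, not_false_eq_true, zero_pow]
      rw [← Function.Injective.tsum_eq Subtype.val_injective hz, mul_assoc, mul_comm R, ← mul_assoc,
        ← ENNReal.tsum_mul_left]
      refine ENNReal.tsum_le_tsum fun u => ?_
      rw [hin, if_neg u.2]
      calc ‖⟪T (e u), y⟫_ℂ‖ₑ ^ 2 ≤ (‖T (e u)‖ₑ * ‖y‖ₑ) ^ 2 := by
            gcongr
            exact ENNReal.coe_le_coe.mpr (nnnorm_inner_le_nnnorm _ _)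
        _ = ‖T (e u)‖ₑ ^ 2 * ‖y‖ₑ ^ 2 := mul_pow _ _ _
        _ ≤ (C * ENNReal.ofReal (⟪e u, T (e u)⟫_ℂ).re) * ‖y‖ₑ ^ 2 := by
            gcongr
            exact hC _
        _ = _ := by ring
    have hfin : (C : ENNReal) * R ≠ ⊤ := ENNReal.mul_ne_top ENNReal.coe_ne_top hR
    have hn : ‖T - S F‖ ≤ Real.sqrt ((C : ENNReal) * R).toReal := by
      refine ContinuousLinearMap.opNorm_le_bound _ (Real.sqrt_nonneg _) fun y => ?_
      have := ENNReal.toReal_mono (ENNReal.mul_ne_top hfin (by simp)) (hy y)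
      rw [ENNReal.toReal_mul, ENNReal.toReal_pow, ENNReal.toReal_pow, toReal_enorm,
        toReal_enorm] at this
      refine le_of_sq_le_sq ?_ (by positivity)
      rwa [mul_pow, Real.sq_sqrt ENNReal.toReal_nonneg]
    rw [← ofReal_sq_norm, ENNReal.ofReal_le_iff_le_toReal hfin]
    calc ‖T - S F‖ ^ 2 ≤ (Real.sqrt ((C : ENNReal) * R).toReal) ^ 2 := by gcongr
      _ = _ := Real.sq_sqrt ENNReal.toReal_nonneg
  have hlim : Filter.Tendsto S Filter.atTop (nhds T) := by
    rw [tendsto_iff_edist_tendsto_0]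
    have h0 := ENNReal.tendsto_tsum_compl_atTop_zero h
    have h1 := ENNReal.Tendsto.const_mul (a := (C : ENNReal)) h0 (Or.inr ENNReal.coe_ne_top)
    rw [mul_zero] at h1
    have h2 : Filter.Tendsto (fun F => ‖T - S F‖ₑ ^ 2) Filter.atTop (nhds 0) :=
      tendsto_of_tendsto_of_tendsto_of_le_of_le tendsto_const_nhds h1 (fun _ => zero_le) hb
    have h3 := (ENNReal.continuous_rpow_const (y := 1 / 2)).tendsto 0 |>.comp h2
    rw [ENNReal.zero_rpow_of_pos (by norm_num)] at h3
    refine h3.congr fun F => ?_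
    rw [Function.comp_apply, ← ENNReal.rpow_natCast, ← ENNReal.rpow_mul, edist_comm,
      edist_eq_enorm_sub]
    norm_num
  exact isCompactOperator_of_tendsto hlim (Filter.Eventually.of_forall hS)

/-- Orthonormal bases of mutually orthogonal subspaces that span a dense subspace combine to an
orthonormal basis. -/
theorem exists_hilbertBasis_sigma {ι : Type*} {V : ι → Submodule ℂ E} [∀ i, CompleteSpace (V i)]
    (hV : OrthogonalFamily ℂ (fun i => V i) fun i => (V i).subtypeₗᵢ) (hbot : (⨆ i, V i)ᗮ = ⊥) :
    ∃ (w : ∀ i, Set (V i)) (φ : HilbertBasis (Σ i, w i) ℂ E), ∀ i, φ i ∈ V i.1 := by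
  choose w b hb using fun i => exists_hilbertBasis ℂ (V i)
  have hon : Orthonormal ℂ fun i : Σ i, w i => (b i.1 i.2 : E) :=
    hV.orthonormal_sigma_orthonormal fun i => (b i).orthonormal
  have htot : (Submodule.span ℂ (Set.range fun i : Σ i, w i => (b i.1 i.2 : E)))ᗮ = ⊥ := by
    rw [eq_bot_iff, ← hbot, ← Submodule.orthogonal_closure]
    refine Submodule.orthogonal_le (iSup_le fun i y hy => ?_)
    have h1 := ((b i).hasSum_repr ⟨y, hy⟩).mapL (V i).subtypeL
    refine (Submodule.isClosed_topologicalClosure _).mem_of_tendsto h1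
      (Filter.Eventually.of_forall fun F => ?_)
    refine Submodule.sum_mem _ fun j _ => Submodule.le_topologicalClosure _ ?_
    rw [map_smul]
    exact Submodule.smul_mem _ _ (Submodule.subset_span ⟨⟨i, j⟩, rfl⟩)
  refine ⟨w, HilbertBasis.mkOfOrthogonalEqBot hon htot, fun i => ?_⟩
  rw [HilbertBasis.coe_mkOfOrthogonalEqBot]
  exact (b i.1 i.2).2

/-- A positive operator of finite trace has an orthonormal eigenbasis. -/
theorem exists_isEigenbasis {T : E →L[ℂ] E} (hT : T.IsPositive)
    (e : HilbertBasis κ ℂ E) (h : ∑' u, ENNReal.ofReal (⟪e u, T (e u)⟫_ℂ).re ≠ ⊤) :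
    ∃ (κ' : Type u) (φ : HilbertBasis κ' ℂ E) (x : κ' → ℝ), IsEigenbasis φ T x := by
  have hs := hT.isSymmetric
  have hbot := ContinuousLinearMap.orthogonalComplement_iSup_eigenspaces_eq_bot
    (isCompactOperator_of_tsum_diag hT e h) hs
  have hclosed : ∀ μ : ℂ, IsClosed (Module.End.eigenspace (T : Module.End ℂ E) μ : Set E) := by
    intro μ
    have : (Module.End.eigenspace (T : Module.End ℂ E) μ : Set E) = {y | T y = μ • y} := by
      ext y
      simp
    rw [this]
    exact isClosed_eq T.continuous (continuous_const_smul μ)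
  have : ∀ μ : ℂ, CompleteSpace (Module.End.eigenspace (T : Module.End ℂ E) μ) := fun μ =>
    (hclosed μ).completeSpace_coe
  -- All complex `μ` are used as indices: non-eigenvalues contribute an empty basis, and `μ = 0`
  -- contributes the kernel.
  obtain ⟨w, φ, hφ⟩ := exists_hilbertBasis_sigma hs.orthogonalFamily_eigenspaces hbot
  have hv : ∀ i, T (φ i) = i.1 • φ i := fun i => Module.End.mem_eigenspace_iff.mp (hφ i)
  refine ⟨_, φ, fun i => i.1.re, fun i => ?_⟩
  have h1 := hs.conj_eigenvalue_eq_self (μ := i.1)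
    (Module.End.hasEigenvalue_of_hasEigenvector ⟨hφ i, φ.orthonormal.ne_zero i⟩)
  rw [hv, Complex.conj_eq_iff_re.mp h1]

/-- The functional calculus acts on eigenvectors through the eigenvalue. -/
theorem cfc_apply_eigenvector {f : ℝ → ℝ} (hf : Continuous f) {X : E →L[ℂ] E}
    (hX : IsSelfAdjoint X) {v : E} (hv : v ≠ 0) {t : ℝ} (h : X v = (t : ℂ) • v) :
    cfc f X v = (f t : ℂ) • v := by
  have ht : t ∈ spectrum ℝ X := by
    rw [spectrum.mem_iff]
    rintro ⟨U, hU⟩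
    apply hv
    have h1 : (U : E →L[ℂ] E) v = 0 := by
      rw [hU, sub_apply, h, Algebra.algebraMap_eq_smul_one]
      simp
    have h2 : ((↑U⁻¹ : E →L[ℂ] E) * (U : E →L[ℂ] E)) v = v := by
      rw [Units.inv_mul]
      rfl
    rw [← h2, mul_apply_eq_comp, h1, map_zero]
  rw [cfc_apply f X hX hf.continuousOn]
  -- The property holds for constants and the identity, passes to sums and products, and is closed
  -- under limits, so Stone–Weierstrass gives it for every continuous function.
  have key : ∀ g : C(spectrum ℝ X, ℝ), cfcHom hX g v = (g ⟨t, ht⟩ : ℂ) • v := by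
    intro g
    have hid : cfcHom hX (ContinuousMap.restrict (spectrum ℝ X) (ContinuousMap.id ℝ)) = X :=
      cfcHom_id hX
    induction g using ContinuousMap.induction_on_of_compact with
    | const r =>
      have : ContinuousMap.const (spectrum ℝ X) r = algebraMap ℝ C(spectrum ℝ X, ℝ) r := rfl
      rw [this, AlgHomClass.commutes, Algebra.algebraMap_eq_smul_one]
      simp
    | id => rw [hid, h]; rfl
    | star_id => rw [map_star, hid, hX.star_eq, h]; rfl
    | add f g hf hg => rw [map_add, add_apply, hf, hg, ← add_smul]; simp
    | mul f g hf hg => rw [map_mul, mul_apply_eq_comp, hg, map_smul, hf, smul_smul]; simp [mul_comm]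
    | frequently f hf =>
      have hcl : IsClosed {g : C(spectrum ℝ X, ℝ) | cfcHom hX g v = (g ⟨t, ht⟩ : ℂ) • v} := by
        refine isClosed_eq ?_ ?_
        · exact (ContinuousLinearMap.apply ℂ E v).continuous.comp (cfcHom_continuous hX)
        · exact (Complex.continuous_ofReal.comp (continuous_eval_const _)).smul
            continuous_const
      exact hcl.mem_of_frequently_of_tendsto hf Filter.tendsto_id
  rw [key]
  rfl

theorem IsEigenbasis.cfc {f : ℝ → ℝ} (hf : Continuous f) (h : IsEigenbasis φ X x)
    (hX : IsSelfAdjoint X) : IsEigenbasis φ (cfc f X) fun k => f (x k) := fun k =>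
  cfc_apply_eigenvector hf hX (φ.orthonormal.ne_zero k) (h k)

theorem IsEigenbasis.entropy_eq (h : IsEigenbasis φ X x) (hX : IsSelfAdjoint X)
    (h0 : ∀ k, 0 ≤ x k) (h1 : ∀ k, x k ≤ 1) :
    entropy X = ∑' k, ENNReal.ofReal (Real.negMulLog (x k)) :=
  (h.cfc Real.continuous_negMulLog hX).posTrace_eq fun k => Real.negMulLog_nonneg (h0 k) (h1 k)

open Classical in
/-- An eigenprojector is diagonal in every eigenbasis. -/
theorem IsEigenbasis.eigenprojector (h : IsEigenbasis φ X x) (t : ℝ) :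
    IsEigenbasis φ (eigenprojector X t) fun k => if x k = t then 1 else 0 := by
  intro k
  unfold Fermion.eigenprojector
  dsimp only
  split_ifs with hk
  · rw [Complex.ofReal_one, one_smul, Submodule.starProjection_eq_self_iff,
      LinearMap.mem_ker]
    simp [h k, hk]
  · rw [Complex.ofReal_zero, zero_smul, Submodule.starProjection_apply_eq_zero_iff,
      Submodule.mem_orthogonal']
    intro u hu
    have hu' : X u = (t : ℂ) • u := by
      rw [LinearMap.mem_ker] at hu
      simpa [sub_eq_zero] using hu
    have h1 := h.inner_apply k u
    rw [hu', inner_smul_right] at h1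
    have h2 : ((x k : ℂ) - t) * ⟪φ k, u⟫_ℂ = 0 := by rw [sub_mul, h1, sub_self]
    rcases mul_eq_zero.mp h2 with h3 | h3
    · exact absurd (by exact_mod_cast sub_eq_zero.mp h3) hk
    · exact h3

-- For the two projectors `P` and `Q`, `⟨u, P Q P u⟩` is the sum of `|⟨u, P ψ l⟩|²` over the `l`
-- with `y l = t`. Summing over a basis `u` leaves `‖P ψ l‖²`, which Parseval in `φ` evaluates.
open Classical in
theorem IsEigenbasis.posTrace_eigenprojector_mul {ψ : HilbertBasis κ' ℂ E} {Y : E →L[ℂ] E}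
    {y : κ' → ℝ} (hX : IsEigenbasis φ X x) (hY : IsEigenbasis ψ Y y) (s t : ℝ) :
    posTrace (Fermion.eigenprojector X s * Fermion.eigenprojector Y t *
        Fermion.eigenprojector X s) =
      ∑' k, ∑' l, if x k = s ∧ y l = t then ‖⟪φ k, ψ l⟫_ℂ‖ₑ ^ 2 else 0 := by
  have hQ := hY.eigenprojector t
  have hP := hX.eigenprojector s
  set P := Fermion.eigenprojector X s
  set Q := Fermion.eigenprojector Y t
  have hPs : ∀ u v, ⟪P u, v⟫_ℂ = ⟪u, P v⟫_ℂ := Submodule.inner_starProjection_left_eq_right _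
  have hdiag : ∀ u, ENNReal.ofReal (⟪u, (P * Q * P) u⟫_ℂ).re =
      ∑' l, (if y l = t then 1 else 0) * ‖⟪u, P (ψ l)⟫_ℂ‖ₑ ^ 2 := by
    intro u
    rw [mul_apply_eq_comp, mul_apply_eq_comp, ← hPs, hQ.ofReal_re_inner (fun l => by
      split_ifs <;> simp)]
    refine tsum_congr fun l => ?_
    rw [enorm_inner_symm, hPs]
    split_ifs <;> simp
  unfold posTrace
  simp only [hdiag]
  rw [ENNReal.tsum_comm, ENNReal.tsum_comm (α := κ)]
  refine tsum_congr fun l => ?_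
  rw [ENNReal.tsum_mul_left]
  simp only [enorm_inner_symm _ (P (ψ l)), tsum_enorm_inner_sq']
  rw [← tsum_enorm_inner_sq φ, ← ENNReal.tsum_mul_left]
  refine tsum_congr fun k => ?_
  rw [hP.inner_apply]
  by_cases h1 : x k = s <;> by_cases h2 : y l = t <;> simp [h1, h2]

/-- Each pair `(k, l)` contributes to exactly one pair of eigenvalues `(s, t)`, namely `(x k, y l)`,
so the sums over real numbers collapse. -/
theorem IsEigenbasis.relEntropy_eq {ψ : HilbertBasis κ' ℂ E} {Y : E →L[ℂ] E}
    {y : κ' → ℝ} (hX : IsEigenbasis φ X x) (hY : IsEigenbasis ψ Y y) (hker : Y.ker ≤ X.ker) :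
    relEntropy X Y = ∑' k, ∑' l, ‖⟪φ k, ψ l⟫_ℂ‖ₑ ^ 2 *
      ENNReal.ofReal (x k * Real.log (x k) - x k * Real.log (y l) + y l - x k) := by
  classical
  rw [relEntropy, if_pos hker]
  simp only [hX.posTrace_eigenprojector_mul hY, ← ENNReal.tsum_mul_right]
  have h1 : ∀ s : ℝ, (∑' (t : ℝ) (k) (l), (if x k = s ∧ y l = t then ‖⟪φ k, ψ l⟫_ℂ‖ₑ ^ 2 else 0) *
      ENNReal.ofReal (s * Real.log s - s * Real.log t + t - s)) =
      ∑' k, ∑' l, if s = x k then ‖⟪φ k, ψ l⟫_ℂ‖ₑ ^ 2 *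
        ENNReal.ofReal (s * Real.log s - s * Real.log (y l) + y l - s) else 0 := by
    intro s
    rw [ENNReal.tsum_comm]
    refine tsum_congr fun k => ?_
    rw [ENNReal.tsum_comm]
    refine tsum_congr fun l => ?_
    rw [tsum_eq_single (y l) fun t ht => by rw [if_neg fun h => ht h.2.symm, zero_mul]]
    simp [eq_comm]
  simp only [h1]
  rw [ENNReal.tsum_comm]
  refine tsum_congr fun k => ?_
  rw [ENNReal.tsum_comm]
  refine tsum_congr fun l => ?_
  rw [tsum_eq_single (x k) fun s hs => if_neg hs, if_pos rfl]

/-- The trace of the product of a trace-class operator and a bounded one, in an eigenbasis of the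
former. -/
theorem IsEigenbasis.hasSum_trace (h : IsEigenbasis φ X x) (hx : Summable x) (h0 : ∀ k, 0 ≤ x k)
    (B : E →L[ℂ] E) : HasSum (fun k => (x k : ℂ) * ⟪φ k, B (φ k)⟫_ℂ) (trace (X * B)) := by
  let e := onb E
  -- Summed over the reference basis first, this family gives `x k * ⟪φ k, B (φ k)⟫`; summed over
  -- `k` first, it gives the diagonal of `X * B`. Absolute summability follows from `hab` and
  -- Parseval.
  let f : κ × onbSet E → ℂ := fun p =>
    (x p.1 : ℂ) * (⟪ContinuousLinearMap.adjoint B (φ p.1), e p.2⟫_ℂ * ⟪e p.2, φ p.1⟫_ℂ)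
  have hab : ∀ a b : ENNReal, a * b ≤ a ^ 2 + b ^ 2 := fun a b => by
    rcases le_total a b with hab | hab
    · exact le_add_left ((mul_le_mul_left hab b).trans_eq (sq b).symm)
    · exact le_add_right ((mul_le_mul_right hab a).trans_eq (sq a).symm)
  have hf : Summable f := by
    refine Summable.of_enorm (ne_top_of_le_ne_top (b := ∑' k, ENNReal.ofReal (x k) *
      (‖ContinuousLinearMap.adjoint B‖ₑ ^ 2 + 1)) ?_ ?_)
    · rw [ENNReal.tsum_mul_right]
      exact ENNReal.mul_ne_top hx.tsum_ofReal_ne_top (by simp)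
    · rw [ENNReal.tsum_prod']
      refine ENNReal.tsum_le_tsum fun k => ?_
      have h1 : ∀ u, ‖f (k, u)‖ₑ ≤ ENNReal.ofReal (x k) *
          (‖⟪ContinuousLinearMap.adjoint B (φ k), e u⟫_ℂ‖ₑ ^ 2 + ‖⟪e u, φ k⟫_ℂ‖ₑ ^ 2) := by
        intro u
        rw [enorm_mul, enorm_mul, ← ofReal_norm (x k : ℂ), Complex.norm_of_nonneg (h0 k)]
        gcongr
        exact hab _ _
      refine (ENNReal.tsum_le_tsum h1).trans ?_
      rw [ENNReal.tsum_mul_left, ENNReal.tsum_add, tsum_enorm_inner_sq', tsum_enorm_inner_sq]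
      have h2 : ‖φ k‖ₑ = 1 := by rw [← ofReal_norm, φ.orthonormal.1, ENNReal.ofReal_one]
      have h3 := (ContinuousLinearMap.adjoint B).le_opENorm (φ k)
      rw [h2, mul_one] at h3
      rw [h2, one_pow]
      gcongr
  have hk : ∀ k, HasSum (fun u => f (k, u)) ((x k : ℂ) * ⟪φ k, B (φ k)⟫_ℂ) := by
    intro k
    have := (e.hasSum_inner_mul_inner (ContinuousLinearMap.adjoint B (φ k)) (φ k)).mul_left (x k : ℂ)
    rwa [ContinuousLinearMap.adjoint_inner_left] at this
  have hu : ∀ u, HasSum (fun k => f (k, u)) ⟪e u, (X * B) (e u)⟫_ℂ := by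
    intro u
    have := (h.hasSum_apply (B (e u))).mapL (innerSL ℂ (e u))
    refine (congrArg (HasSum · _) (funext fun k => ?_)).mpr this
    simp only [f, innerSL_apply_apply, inner_smul_right, ContinuousLinearMap.adjoint_inner_left,
      mul_assoc]
  have h1 := hf.hasSum.prod_fiberwise hk
  have h2 := ((Equiv.prodComm _ _).hasSum_iff.mpr hf.hasSum).prod_fiberwise hu
  rwa [← h2.tsum_eq] at h1

/-- An orthonormal family extends to an orthonormal basis. -/
theorem exists_hilbertBasis_extension {v : κ → E} (hv : Orthonormal ℂ v) :
    ∃ (κ' : Type u) (ψ : HilbertBasis (κ ⊕ κ') ℂ E), ∀ i, ψ (Sum.inl i) = v i := by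
  obtain ⟨w, b, -⟩ := exists_hilbertBasis ℂ (Submodule.span ℂ (Set.range v))ᗮ
  have hmem : ∀ i, v i ∈ Submodule.span ℂ (Set.range v) := fun i => Submodule.subset_span ⟨i, rfl⟩
  have hon : Orthonormal ℂ (Sum.elim v fun i => (b i : E)) := by
    have hb : Orthonormal ℂ fun i => (b i : E) := b.orthonormal.comp_linearIsometry
      (Submodule.subtypeₗᵢ _)
    refine ⟨?_, ?_⟩
    · rintro (i | i)
      exacts [hv.1 i, hb.1 i]
    · rintro (i | i) (j | j) hij
      · exact hv.2 fun h => hij (congrArg _ h)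
      · exact (b j).2 _ (hmem i)
      · exact inner_eq_zero_symm.mp ((b i).2 _ (hmem j))
      · exact hb.2 fun h => hij (congrArg _ h)
  have htot : (Submodule.span ℂ (Set.range (Sum.elim v fun i => (b i : E))))ᗮ = ⊥ := by
    rw [eq_bot_iff]
    intro y hy
    rw [Submodule.mem_orthogonal] at hy
    have h1 : y ∈ (Submodule.span ℂ (Set.range v))ᗮ := by
      rw [Submodule.mem_orthogonal]
      exact fun u hu => hy u (Submodule.span_mono (by
        rintro _ ⟨i, rfl⟩
        exact ⟨Sum.inl i, rfl⟩) hu)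
    have h2 : (⟨y, h1⟩ : (Submodule.span ℂ (Set.range v))ᗮ) = 0 := by
      rw [← enorm_eq_zero, ← pow_eq_zero_iff two_ne_zero, ← tsum_enorm_inner_sq b,
        ENNReal.tsum_eq_zero]
      intro i
      have : ⟪(b i : E), y⟫_ℂ = 0 := hy _ (Submodule.subset_span ⟨Sum.inr i, rfl⟩)
      rw [Submodule.coe_inner, this]
      simp
    exact congrArg Subtype.val h2
  refine ⟨w, HilbertBasis.mkOfOrthogonalEqBot hon htot, fun i => ?_⟩
  rw [HilbertBasis.coe_mkOfOrthogonalEqBot]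
  rfl

end Eigenbases

/-! ### Creators and annihilators on Fock space and their anticommutation relations -/

section CAR

variable {H : Type*} [NormedAddCommGroup H] [InnerProductSpace ℂ H]

/-- The image of the exterior algebra in Fock space. -/
def toFock : ExteriorAlgebra ℂ H →ₗ[ℂ] FockSpace H :=
  (UniformSpace.Completion.toComplL : PreFock H →L[ℂ] FockSpace H).toLinearMap ∘ₗ
    toPreFock.toLinearMap

theorem toFock_apply (y : ExteriorAlgebra ℂ H) :
    toFock y = ((toPreFock y : PreFock H) : UniformSpace.Completion (PreFock H)) := rfl

theorem denseRange_toFock : DenseRange (toFock : ExteriorAlgebra ℂ H → FockSpace H) :=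
  UniformSpace.Completion.denseRange_coe (α := PreFock H)

theorem inner_toFock (x y : ExteriorAlgebra ℂ H) :
    ⟪toFock x, toFock y⟫_ℂ = wedgeInner x y := by
  rw [toFock_apply, toFock_apply, UniformSpace.Completion.inner_coe, inner_toPreFock]

theorem vacuum_eq : (vacuum : FockSpace H) = toFock 1 := rfl

theorem creator_toFock (h : H) (y : ExteriorAlgebra ℂ H) :
    creator h (toFock y) = toFock (ExteriorAlgebra.ι ℂ h * y) := by
  rw [creator, toFock_apply, ContinuousLinearMap.completion_apply_coe]
  rfl

theorem fock_ext {S T : FockSpace H →L[ℂ] FockSpace H}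
    (h : ∀ y : ExteriorAlgebra ℂ H, S (toFock y) = T (toFock y)) : S = T :=
  DFunLike.coe_injective (denseRange_toFock.equalizer S.continuous T.continuous (funext h))

theorem annihilator_toFock (h : H) (y : ExteriorAlgebra ℂ H) :
    annihilator h (toFock y) = toFock (contract h y) := by
  refine ext_inner_right ℂ fun v => ?_
  rw [annihilator, ContinuousLinearMap.adjoint_inner_left]
  induction v using denseRange_toFock.induction_on with
  | hp => exact isClosed_eq (by fun_prop) (by fun_prop)
  | ih z => rw [creator_toFock, inner_toFock, inner_toFock, wedgeInner_contract]

theorem creator_add (g h : H) : creator (g + h) = creator g + creator h :=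
  fock_ext fun y => by
    simp only [add_apply, creator_toFock, map_add, add_mul]

theorem creator_smul (c : ℂ) (h : H) : creator (c • h) = c • creator h :=
  fock_ext fun y => by
    simp only [smul_apply, creator_toFock, map_smul, smul_mul_assoc]

theorem norm_creator_le (h : H) : ‖creator h‖ ≤ ‖h‖ := by
  refine ContinuousLinearMap.opNorm_le_bound _ (norm_nonneg _) fun u => ?_
  induction u using denseRange_toFock.induction_on with
  | hp => exact isClosed_le (by fun_prop) (by fun_prop)
  | ih y =>
    rw [creator_toFock, toFock_apply, toFock_apply, UniformSpace.Completion.norm_coe,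
      UniformSpace.Completion.norm_coe]
    exact norm_preCreator_le h (toPreFock y)

/-- `h ↦ a†_h` as a continuous linear map. -/
def creatorL : H →L[ℂ] FockSpace H →L[ℂ] FockSpace H :=
  LinearMap.mkContinuous { toFun := creator, map_add' := creator_add, map_smul' := creator_smul } 1
    fun h => (norm_creator_le h).trans_eq (one_mul _).symm

theorem annihilator_add (g h : H) : annihilator (g + h) = annihilator g + annihilator h := by
  simp [annihilator, creator_add]

theorem annihilator_smul (c : ℂ) (h : H) :
    annihilator (c • h) = starRingEnd ℂ c • annihilator h := by
  rw [annihilator, creator_smul, map_smulₛₗ, annihilator]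

theorem norm_annihilator_le (h : H) : ‖annihilator h‖ ≤ ‖h‖ := by
  rw [annihilator, LinearIsometryEquiv.norm_map]
  exact norm_creator_le h

/-- The canonical anticommutation relation. -/
theorem annihilator_creator (g h : H) (u : FockSpace H) :
    annihilator h (creator g u) = ⟪h, g⟫_ℂ • u - creator g (annihilator h u) := by
  induction u using denseRange_toFock.induction_on with
  | hp =>
    exact isClosed_eq ((annihilator h).continuous.comp (creator g).continuous)
      ((continuous_const_smul _).sub ((creator g).continuous.comp (annihilator h).continuous))
  | ih y =>
    rw [creator_toFock, annihilator_toFock, annihilator_toFock, creator_toFock]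
    exact (congrArg toFock (contract_ι_mul h g y)).trans (by rw [map_sub, map_smul])

theorem creator_creator (g h : H) (u : FockSpace H) :
    creator g (creator h u) = -creator h (creator g u) := by
  induction u using denseRange_toFock.induction_on with
  | hp => exact isClosed_eq (by fun_prop) (by fun_prop)
  | ih y =>
    have := eq_neg_of_add_eq_zero_left (ExteriorAlgebra.ι_add_mul_swap (R := ℂ) g h)
    simp only [creator_toFock, ← mul_assoc, this, neg_mul, map_neg]

theorem creator_self (h : H) (u : FockSpace H) : creator h (creator h u) = 0 := by
  have := creator_creator h h u
  rwa [eq_neg_iff_add_eq_zero, ← two_smul ℂ, smul_eq_zero_iff_right two_ne_zero] at this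

theorem annihilator_vacuum (h : H) : annihilator h (vacuum : FockSpace H) = 0 := by
  rw [vacuum_eq, annihilator_toFock]
  have := contract_algebraMap h 1
  rw [map_one] at this
  rw [this, map_zero]

theorem norm_vacuum : ‖(vacuum : FockSpace H)‖ = 1 := by
  have h1 : ⟪(vacuum : FockSpace H), vacuum⟫_ℂ = 1 := by
    rw [vacuum_eq, inner_toFock]
    simp [wedgeInner]
  have h2 : ‖(vacuum : FockSpace H)‖ ^ 2 = 1 := by
    rw [← inner_self_eq_norm_sq (𝕜 := ℂ), h1]
    rfl
  exact (pow_eq_one_iff_of_nonneg (norm_nonneg _) two_ne_zero).mp h2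

theorem inner_creator (h : H) (u v : FockSpace H) :
    ⟪creator h u, v⟫_ℂ = ⟪u, annihilator h v⟫_ℂ :=
  (ContinuousLinearMap.adjoint_inner_right _ _ _).symm

theorem inner_annihilator (h : H) (u v : FockSpace H) :
    ⟪annihilator h u, v⟫_ℂ = ⟪u, creator h v⟫_ℂ :=
  ContinuousLinearMap.adjoint_inner_left _ _ _

/-- The sum of `a†_h a_h` and `a_h a†_h` is `‖h‖²`. -/
theorem norm_sq_annihilator_add_norm_sq_creator (h : H) (u : FockSpace H) :
    ‖annihilator h u‖ ^ 2 + ‖creator h u‖ ^ 2 = ‖h‖ ^ 2 * ‖u‖ ^ 2 := by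
  have h1 : ⟪annihilator h u, annihilator h u⟫_ℂ + ⟪creator h u, creator h u⟫_ℂ =
      ⟪h, h⟫_ℂ * ⟪u, u⟫_ℂ := by
    rw [inner_creator, annihilator_creator, inner_sub_right, inner_smul_right, inner_annihilator]
    ring
  simp only [inner_self_eq_norm_sq_to_K] at h1
  exact_mod_cast h1

end CAR

/-! ### Slater determinants: occupation numbers, orthonormality, completeness -/

section Slater

variable {H : Type*} [NormedAddCommGroup H] [InnerProductSpace ℂ H]
variable {κ : Type*} (e : κ → H)

/-- The vector `a†_{e j₁} ⋯ a†_{e jₙ} Ω` for the list `[j₁, …, jₙ]`. -/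
def wedgeVec (l : List κ) : FockSpace H := (l.map fun j => creator (e j)).prod vacuum

theorem wedgeVec_nil : wedgeVec e [] = vacuum := rfl

theorem wedgeVec_cons (j : κ) (l : List κ) :
    wedgeVec e (j :: l) = creator (e j) (wedgeVec e l) := by
  rw [wedgeVec, List.map_cons, List.prod_cons]
  rfl

/-- Creators anticommute. The sign is left open because the use is membership in a span. -/
theorem wedgeVec_perm {l l' : List κ} (h : l.Perm l') :
    wedgeVec e l = wedgeVec e l' ∨ wedgeVec e l = -wedgeVec e l' := by
  induction h with
  | nil => exact Or.inl rfl
  | cons j _ ih =>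
    rw [wedgeVec_cons, wedgeVec_cons]
    exact ih.imp (congrArg _) fun h => by rw [h, map_neg]
  | swap i j l =>
    simp only [wedgeVec_cons]
    exact Or.inr (creator_creator _ _ _)
  | trans _ _ h1 h2 =>
    rcases h1 with h1 | h1 <;> rcases h2 with h2 | h2 <;> simp [h1, h2]

variable {e}

open Classical in
/-- Products of creators are eigenvectors of the occupation number operators. -/
theorem occupation_wedgeVec (he : Orthonormal ℂ e) (j : κ) {l : List κ} (hl : l.Nodup) :
    creator (e j) (annihilator (e j) (wedgeVec e l)) = if j ∈ l then wedgeVec e l else 0 := by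
  induction l with
  | nil => simp [wedgeVec_nil, annihilator_vacuum]
  | cons i l ih =>
    rw [List.nodup_cons] at hl
    rw [wedgeVec_cons, annihilator_creator, map_sub, map_smul, creator_creator, ih hl.2,
      orthonormal_iff_ite.mp he]
    by_cases hij : j = i
    · subst hij
      simp [hl.1]
    · by_cases hjl : j ∈ l <;> simp [hij, hjl]

theorem annihilator_wedgeVec (he : Orthonormal ℂ e) {j : κ} {l : List κ} (hl : l.Nodup)
    (hj : j ∉ l) : annihilator (e j) (wedgeVec e l) = 0 := by
  have h1 := occupation_wedgeVec he j hl
  rw [if_neg hj] at h1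
  rw [← inner_self_eq_zero (𝕜 := ℂ), inner_annihilator, h1, inner_zero_right]

theorem norm_wedgeVec (he : Orthonormal ℂ e) {l : List κ} (hl : l.Nodup) : ‖wedgeVec e l‖ = 1 := by
  induction l with
  | nil => exact norm_vacuum
  | cons i l ih =>
    rw [List.nodup_cons] at hl
    have h1 := norm_sq_annihilator_add_norm_sq_creator (e i) (wedgeVec e l)
    rw [annihilator_wedgeVec he hl.2 hl.1, ih hl.2, he.1] at h1
    rw [wedgeVec_cons]
    exact (pow_eq_one_iff_of_nonneg (norm_nonneg _) two_ne_zero).mp (by simpa using h1)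

variable [LinearOrder κ]

variable (e) in
/-- The Slater determinant of the members of a finite set of an ordered family. -/
def slaterVec (s : Finset κ) : FockSpace H := wedgeVec e (s.sort (· ≤ ·)).reverse

theorem nodup_sort_reverse (s : Finset κ) : (s.sort (· ≤ ·)).reverse.Nodup :=
  List.nodup_reverse.mpr (s.sort_nodup _)

theorem mem_sort_reverse {s : Finset κ} {j : κ} : j ∈ (s.sort (· ≤ ·)).reverse ↔ j ∈ s := by simp

theorem occupation_slaterVec (he : Orthonormal ℂ e) (j : κ) (s : Finset κ) :
    creator (e j) (annihilator (e j) (slaterVec e s)) = if j ∈ s then slaterVec e s else 0 := by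
  classical
  rw [slaterVec, occupation_wedgeVec he j (nodup_sort_reverse s)]
  simp only [mem_sort_reverse]

/-- For distinct sets, some `j` lies in exactly one of them. The symmetric operator `a†ⱼ aⱼ` then
has eigenvalue `1` on one vector and `0` on the other, which forces orthogonality. -/
theorem orthonormal_slaterVec (he : Orthonormal ℂ e) : Orthonormal ℂ (slaterVec e) := by
  refine ⟨fun s => norm_wedgeVec he (nodup_sort_reverse s), fun s t hst => ?_⟩
  have h1 : ∀ j, (if j ∈ s then ⟪slaterVec e s, slaterVec e t⟫_ℂ else 0) =
      if j ∈ t then ⟪slaterVec e s, slaterVec e t⟫_ℂ else 0 := by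
    intro j
    have h2 : ⟪creator (e j) (annihilator (e j) (slaterVec e s)), slaterVec e t⟫_ℂ =
        ⟪slaterVec e s, creator (e j) (annihilator (e j) (slaterVec e t))⟫_ℂ := by
      rw [inner_creator, inner_annihilator]
    rw [occupation_slaterVec he, occupation_slaterVec he] at h2
    by_cases hs : j ∈ s <;> by_cases ht : j ∈ t <;> simp_all
  obtain ⟨j, hj⟩ := not_forall.mp fun h => hst (Finset.ext h)
  have := h1 j
  by_cases hs : j ∈ s <;> by_cases ht : j ∈ t <;> simp_all

theorem creator_slaterVec_mem (he : Orthonormal ℂ e) (j : κ) (s : Finset κ) :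
    creator (e j) (slaterVec e s) ∈ Submodule.span ℂ (Set.range (slaterVec e)) := by
  by_cases hj : j ∈ s
  · have h1 := occupation_slaterVec he j s
    rw [if_pos hj] at h1
    rw [← h1, creator_self]
    -- For `j ∈ s` the determinant is itself in the range of `a†ⱼ`, whose square is zero.
    exact Submodule.zero_mem _
  · have hp : (j :: (s.sort (· ≤ ·)).reverse).Perm ((insert j s).sort (· ≤ ·)).reverse := by
      rw [List.perm_ext_iff_of_nodup _ (nodup_sort_reverse _)]
      · simp
      · exact List.nodup_cons.mpr ⟨fun h => hj (mem_sort_reverse.mp h), nodup_sort_reverse s⟩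
    have h2 := wedgeVec_perm e hp
    rw [wedgeVec_cons] at h2
    have h3 : slaterVec e (insert j s) ∈ Submodule.span ℂ (Set.range (slaterVec e)) :=
      Submodule.subset_span ⟨_, rfl⟩
    rcases h2 with h2 | h2
    · exact h2 ▸ h3
    · exact h2 ▸ Submodule.neg_mem _ h3

variable [CompleteSpace H]

/-- A vector of Fock space that is annihilated by all `a_h` with `h` orthogonal to the `e j`, and
orthogonal to the Slater determinants of the `e j`, vanishes. -/
theorem eq_zero_of_inner_slaterVec (he : Orthonormal ℂ e) {u : FockSpace H}
    (h1 : ∀ h, (∀ j, ⟪e j, h⟫_ℂ = 0) → annihilator h u = 0)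
    (h2 : ∀ s, ⟪slaterVec e s, u⟫_ℂ = 0) : u = 0 := by
  -- `K` contains the vacuum and is stable under creators from `V`; `J` is stable under all creators
  -- and absorbs those from `Vᗮ`. Hence `K ⊔ J` contains the dense image of the exterior algebra,
  -- while `h2` and `h1` make `u` orthogonal to `K` and `J`.
  let V := (Submodule.span ℂ (Set.range e)).topologicalClosure
  let K := (Submodule.span ℂ (Set.range (slaterVec e))).topologicalClosure
  let J := ⨆ h : Vᗮ, LinearMap.range (creator (h : H)).toLinearMap
  have hV : ∀ h ∈ Vᗮ, ∀ j, ⟪e j, h⟫_ℂ = 0 := fun h hh j =>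
    hh _ (Submodule.le_topologicalClosure _ (Submodule.subset_span ⟨j, rfl⟩))
  have hJ : ∀ h ∈ Vᗮ, ∀ y, creator h y ∈ J := fun h hh y =>
    Submodule.mem_iSup_of_mem ⟨h, hh⟩ ⟨y, rfl⟩
  have hJc : ∀ g, ∀ y ∈ J, creator g y ∈ J := by
    intro g y hy
    have : J ≤ J.comap (creator g).toLinearMap := by
      refine iSup_le fun h => ?_
      rintro _ ⟨z, rfl⟩
      change creator g (creator (h : H) z) ∈ J
      rw [creator_creator]
      exact J.neg_mem (hJ _ h.2 _)
    exact this hy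
  have hKc : ∀ g ∈ V, ∀ y ∈ K, creator g y ∈ K := by
    intro g hg y hy
    have hy1 : ∀ j, creator (e j) y ∈ K := by
      intro j
      have h3 : Submodule.span ℂ (Set.range (slaterVec e)) ≤
          K.comap (creator (e j)).toLinearMap := by
        rw [Submodule.span_le]
        rintro _ ⟨s, rfl⟩
        exact Submodule.le_topologicalClosure _ (creator_slaterVec_mem he j s)
      exact Submodule.topologicalClosure_minimal _ h3
        ((Submodule.isClosed_topologicalClosure _).preimage (creator (e j)).continuous) hy
    let ev : H →L[ℂ] FockSpace H := (ContinuousLinearMap.apply ℂ _ y).comp creatorL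
    have h3 : Submodule.span ℂ (Set.range e) ≤ K.comap ev.toLinearMap := by
      rw [Submodule.span_le]
      rintro _ ⟨j, rfl⟩
      exact hy1 j
    exact Submodule.topologicalClosure_minimal _ h3
      ((Submodule.isClosed_topologicalClosure _).preimage ev.continuous) hg
  have hall : ∀ y : ExteriorAlgebra ℂ H, toFock y ∈ K ⊔ J := by
    intro y
    induction y using CliffordAlgebra.left_induction with
    | algebraMap c =>
      have h3 : toFock (algebraMap ℂ (ExteriorAlgebra ℂ H) c) = c • slaterVec e ∅ := by
        rw [Algebra.algebraMap_eq_smul_one, map_smul, ← vacuum_eq]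
        simp [slaterVec, wedgeVec_nil]
      refine (congrArg (· ∈ K ⊔ J) h3).mpr (Submodule.mem_sup_left (Submodule.smul_mem _ _ ?_))
      exact Submodule.le_topologicalClosure _ (Submodule.subset_span ⟨_, rfl⟩)
    | add y y' hy hy' =>
      rw [map_add]
      exact Submodule.add_mem _ hy hy'
    | ι_mul y g hy =>
      have h3 := creator_toFock g y
      refine (congrArg (· ∈ K ⊔ J) h3).mp ?_
      obtain ⟨a, ha, c, hc, hac⟩ := Submodule.mem_sup.mp hy
      obtain ⟨g1, hg1, g2, hg2, hg⟩ := V.exists_add_mem_mem_orthogonal g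
      rw [← hac, map_add]
      refine Submodule.add_mem _ ?_ (Submodule.mem_sup_right (hJc _ _ hc))
      rw [hg, creator_add, add_apply]
      exact Submodule.add_mem _ (Submodule.mem_sup_left (hKc _ hg1 _ ha))
        (Submodule.mem_sup_right (hJ _ hg2 _))
  have hK0 : K ≤ (Submodule.span ℂ {u})ᗮ := by
    refine Submodule.topologicalClosure_minimal _ ?_ (Submodule.isClosed_orthogonal _)
    rw [Submodule.span_le]
    rintro _ ⟨s, rfl⟩
    exact Submodule.mem_orthogonal_singleton_iff_inner_left.mpr (h2 s)
  have hJ0 : J ≤ (Submodule.span ℂ {u})ᗮ := by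
    refine iSup_le fun h => ?_
    rintro _ ⟨z, rfl⟩
    refine Submodule.mem_orthogonal_singleton_iff_inner_left.mpr ?_
    change ⟪creator (h : H) z, u⟫_ℂ = 0
    rw [inner_creator, h1 _ (hV _ h.2), inner_zero_right]
  have hz : ∀ y : FockSpace H, ⟪y, u⟫_ℂ = 0 := by
    intro y
    induction y using denseRange_toFock.induction_on with
    | hp => exact isClosed_eq (by fun_prop) (by fun_prop)
    | ih y => exact Submodule.mem_orthogonal_singleton_iff_inner_left.mp (sup_le hK0 hJ0 (hall y))
  exact inner_self_eq_zero.mp (hz u)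

end Slater

/-! ### Product distributions on finite sets -/

section Weights

variable {κ : Type*} {p : κ → ℝ}

theorem multipliable_one_sub (hp : Summable p) : Multipliable fun j => 1 - p j := by
  simpa only [sub_eq_add_neg] using multipliable_one_add_of_summable (f := fun j => -p j)
    (by simpa only [norm_neg] using hp.norm)

theorem one_sub_sum_le_prod (h0 : ∀ j, 0 ≤ p j) (h1 : ∀ j, p j ≤ 1) (F : Finset κ) :
    1 - ∑ j ∈ F, p j ≤ ∏ j ∈ F, (1 - p j) := by
  classical
  induction F using Finset.induction_on with
  | empty => simp
  | insert j F hj ih =>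
    rw [Finset.sum_insert hj, Finset.prod_insert hj]
    nlinarith [h0 j, h1 j, Finset.sum_nonneg fun i (_ : i ∈ F) => h0 i]

theorem tprod_one_sub_nonneg (hp : Summable p) (h1 : ∀ j, p j ≤ 1) : 0 ≤ ∏' j, (1 - p j) :=
  ge_of_tendsto' (multipliable_one_sub hp).hasProd fun _ =>
    Finset.prod_nonneg fun j _ => sub_nonneg.mpr (h1 j)

theorem tprod_one_sub_le_one (hp : Summable p) (h0 : ∀ j, 0 ≤ p j) (h1 : ∀ j, p j ≤ 1) :
    ∏' j, (1 - p j) ≤ 1 :=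
  le_of_tendsto' (multipliable_one_sub hp).hasProd fun _ =>
    Finset.prod_le_one (fun j _ => sub_nonneg.mpr (h1 j)) fun j _ => by linarith [h0 j]

/-- The union bound in the limit. Applied to the complement of a growing finite set, it shows that
the remaining product tends to `1`. -/
theorem one_sub_tsum_le_tprod (hp : Summable p) (h0 : ∀ j, 0 ≤ p j) (h1 : ∀ j, p j ≤ 1) :
    1 - ∑' j, p j ≤ ∏' j, (1 - p j) :=
  ge_of_tendsto' (multipliable_one_sub hp).hasProd fun F =>
    (sub_le_sub_left (hp.sum_le_tsum F fun j _ => h0 j) 1).trans (one_sub_sum_le_prod h0 h1 F)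

variable (p) in
/-- The probability that the set of occurring events is `s`, for independent events with
probabilities `p j`. -/
def bernoulliWeight (s : Finset κ) : ℝ := (∏ i ∈ s, p i) * ∏' j : {j // j ∉ s}, (1 - p j)

theorem bernoulliWeight_nonneg (hp : Summable p) (h0 : ∀ j, 0 ≤ p j) (h1 : ∀ j, p j ≤ 1)
    (s : Finset κ) : 0 ≤ bernoulliWeight p s :=
  mul_nonneg (Finset.prod_nonneg fun i _ => h0 i)
    (tprod_one_sub_nonneg (hp.subtype _) fun j => h1 j)

open Classical in
theorem tprod_one_sub_compl (hp : Summable p) {s F : Finset κ} (hs : s ⊆ F) :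
    ∏' j : {j // j ∉ s}, (1 - p j) =
      (∏ j ∈ F \ s, (1 - p j)) * ∏' j : {j // j ∉ F}, (1 - p j) := by
  have hind : ∀ t : Finset κ, ∏' j : {j // j ∉ t}, (1 - p j) =
      ∏' j, if j ∈ t then 1 else 1 - p j := by
    intro t
    rw [show (∏' j : {j // j ∉ t}, (1 - p j)) = ∏' j, Set.mulIndicator {j | j ∉ t}
      (fun j => 1 - p j) j from tprod_subtype {j | j ∉ t} fun j => 1 - p j]
    refine tprod_congr fun j => ?_
    by_cases hj : j ∈ t <;> simp [Set.mulIndicator, hj]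
  have h1 : ∀ j, (if j ∈ s then 1 else 1 - p j) =
      (if j ∈ F \ s then 1 - p j else 1) * if j ∈ F then 1 else 1 - p j := by
    intro j
    by_cases hjs : j ∈ s
    · simp [hjs, hs hjs]
    · by_cases hjF : j ∈ F <;> simp [hjs, hjF]
  have h2 : ∀ j ∉ F \ s, (if j ∈ F \ s then 1 - p j else 1) = 1 := fun j hj => if_neg hj
  have h3 : Multipliable fun j => if j ∈ F then 1 else 1 - p j := by
    refine (multipliable_one_sub (hp.indicator {j | j ∉ F})).congr fun j => ?_
    by_cases hj : j ∈ F <;> simp [hj]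
  rw [hind, hind, tprod_congr h1, (multipliable_of_ne_finset_one h2).tprod_mul h3,
    tprod_eq_prod h2]
  congr 1
  exact Finset.prod_congr rfl fun j hj => if_pos hj

/-- The factors inside `F` add up to the expansion of `∏ (p j + (1 - p j)) = 1`; the probability
that nothing outside `F` occurs remains. -/
theorem sum_powerset_bernoulliWeight (hp : Summable p) (F : Finset κ) :
    ∑ s ∈ F.powerset, bernoulliWeight p s = ∏' j : {j // j ∉ F}, (1 - p j) := by
  classical
  have h : ∑ s ∈ F.powerset, (∏ i ∈ s, p i) * ∏ j ∈ F \ s, (1 - p j) = 1 := by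
    rw [← Finset.prod_add]
    simp
  refine Eq.trans ?_ ((congrArg (· * ∏' j : {j // j ∉ F}, (1 - p j)) h).trans (one_mul _))
  simp only [Finset.sum_mul]
  refine Finset.sum_congr rfl fun s hs => ?_
  rw [bernoulliWeight, tprod_one_sub_compl hp (Finset.mem_powerset.mp hs), mul_assoc]

theorem hasSum_bernoulliWeight (hp : Summable p) (h0 : ∀ j, 0 ≤ p j) (h1 : ∀ j, p j ≤ 1) :
    HasSum (bernoulliWeight p) 1 := by
  classical
  have hw := bernoulliWeight_nonneg hp h0 h1
  refine hasSum_of_isLUB_of_nonneg _ hw ⟨?_, fun c hc => ?_⟩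
  · rintro _ ⟨S, rfl⟩
    -- `S.sup id` is the union of the members of `S`, so every partial sum is dominated by a sum
    -- over a powerset.
    have hS : S ⊆ (S.sup id).powerset := fun s hs =>
      Finset.mem_powerset.mpr (Finset.le_sup (f := id) hs)
    refine (Finset.sum_le_sum_of_subset_of_nonneg hS fun s _ _ => hw s).trans ?_
    rw [sum_powerset_bernoulliWeight hp]
    exact tprod_one_sub_le_one (p := fun j : {j // j ∉ S.sup id} => p j) (hp.subtype _)
      (fun j => h0 j) fun j => h1 j
  · have hlim : Filter.Tendsto (fun F : Finset κ => 1 - ∑' j : {j // j ∉ F}, p j) Filter.atTop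
        (nhds (1 - 0)) := tendsto_const_nhds.sub (tendsto_tsum_compl_atTop_zero p)
    rw [sub_zero] at hlim
    refine le_of_tendsto' hlim fun F => ?_
    refine (one_sub_tsum_le_tprod (p := fun j : {j // j ∉ F} => p j) (hp.subtype _)
      (fun j => h0 j) fun j => h1 j).trans ?_
    exact (sum_powerset_bernoulliWeight hp F).symm.trans_le (hc ⟨_, rfl⟩)

theorem summable_log_one_sub (hp : Summable p) : Summable fun j => Real.log (1 - p j) := by
  simpa only [sub_eq_add_neg] using Real.summable_log_one_add_of_summable hp.neg

/-- Summability of `p` makes `∑ log (1 - p j)` converge, so the infinite product is an exponential.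
A weight can vanish only through some `j ∉ s` with `p j = 1`, when `p` is positive and at most `1`.
-/
theorem bernoulliWeight_pos (hp : Summable p) (h0 : ∀ j, 0 < p j) {s : Finset κ}
    (hs : ∀ j ∉ s, p j < 1) : 0 < bernoulliWeight p s := by
  refine mul_pos (Finset.prod_pos fun i _ => h0 i) ?_
  rw [← Real.rexp_tsum_eq_tprod (fun j : {j // j ∉ s} => sub_pos.mpr (hs j j.2))
    (summable_log_one_sub (p := fun j : {j // j ∉ s} => p j) (hp.subtype _))]
  exact Real.exp_pos _

-- Additivity of the logarithm over indices is what reduces the cross entropy to marginals. The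
-- assumption `hs` keeps `log 0` out of the product.
open Classical in
theorem ofReal_neg_log_bernoulliWeight (hp : Summable p) (h0 : ∀ j, 0 < p j) (h1 : ∀ j, p j ≤ 1)
    {s : Finset κ} (hs : ∀ j ∉ s, p j < 1) :
    ENNReal.ofReal (-Real.log (bernoulliWeight p s)) = ∑' j, if j ∈ s then
      ENNReal.ofReal (-Real.log (p j)) else ENNReal.ofReal (-Real.log (1 - p j)) := by
  have hsum : Summable fun j : {j // j ∉ s} => Real.log (1 - p j) :=
    summable_log_one_sub (p := fun j : {j // j ∉ s} => p j) (hp.subtype _)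
  have hexp := Real.rexp_tsum_eq_tprod (fun j : {j // j ∉ s} => sub_pos.mpr (hs j j.2)) hsum
  have hlog : -Real.log (bernoulliWeight p s) =
      ∑ i ∈ s, -Real.log (p i) + ∑' j : {j // j ∉ s}, -Real.log (1 - p j) := by
    rw [bernoulliWeight, ← hexp, Real.log_mul (Finset.prod_pos fun i _ => h0 i).ne'
      (Real.exp_pos _).ne', Real.log_exp, Real.log_prod fun i _ => (h0 i).ne', neg_add,
      Finset.sum_neg_distrib, tsum_neg]
  have hn1 : ∀ i, 0 ≤ -Real.log (p i) := fun i =>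
    neg_nonneg.mpr (Real.log_nonpos (h0 i).le (h1 i))
  have hn2 : ∀ i, 0 ≤ -Real.log (1 - p i) := fun i =>
    neg_nonneg.mpr (Real.log_nonpos (sub_nonneg.mpr (h1 i)) (by linarith [h0 i]))
  rw [hlog, ENNReal.ofReal_add (Finset.sum_nonneg fun i _ => hn1 i) (tsum_nonneg fun j : {j // j ∉ s} => hn2 j),
    ENNReal.ofReal_sum_of_nonneg fun i _ => hn1 i,
    ENNReal.ofReal_tsum_of_nonneg (fun j : {j // j ∉ s} => hn2 j) hsum.neg,
    show (∑' j : {j // j ∉ s}, ENNReal.ofReal (-Real.log (1 - p j))) =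
      ∑' j, Set.indicator {j | j ∉ s} (fun j => ENNReal.ofReal (-Real.log (1 - p j))) j from
      tsum_subtype {j | j ∉ s} fun j => ENNReal.ofReal (-Real.log (1 - p j)),
    sum_eq_tsum_indicator, ← ENNReal.tsum_add]
  refine tsum_congr fun j => ?_
  by_cases hj : j ∈ s <;> simp [Set.indicator, hj]

end Weights

/-! ### Vectors supported on the span of given modes -/

section Occupation

variable {H : Type*} [NormedAddCommGroup H] [InnerProductSpace ℂ H]

theorem annihilator_annihilator (g h : H) (u : FockSpace H) :
    annihilator g (annihilator h u) = -annihilator h (annihilator g u) := by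
  refine ext_inner_right ℂ fun v => ?_
  rw [inner_annihilator, inner_annihilator, inner_neg_left, inner_annihilator, inner_annihilator,
    creator_creator, inner_neg_right]

theorem annihilator_self (h : H) (u : FockSpace H) : annihilator h (annihilator h u) = 0 := by
  refine ext_inner_right ℂ fun v => ?_
  rw [inner_annihilator, inner_annihilator, creator_self, inner_zero_right, inner_zero_left]

variable {κ : Type*} {e : κ → H}

theorem annihilator_wedgeVec_of_orthogonal {h : H} (hh : ∀ j, ⟪e j, h⟫_ℂ = 0) (l : List κ) :
    annihilator h (wedgeVec e l) = 0 := by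
  induction l with
  | nil => exact annihilator_vacuum h
  | cons j l ih =>
    rw [wedgeVec_cons, annihilator_creator, ih, inner_eq_zero_symm.mp (hh j)]
    simp

variable [LinearOrder κ] [CompleteSpace H]

/-- The vectors annihilated by all `a_h` with `h` orthogonal to the `e j` lie in the closed span of
the Slater determinants of the `e j`. -/
theorem mem_closure_span_slaterVec (he : Orthonormal ℂ e) {u : FockSpace H}
    (hu : ∀ h, (∀ j, ⟪e j, h⟫_ℂ = 0) → annihilator h u = 0) :
    u ∈ (Submodule.span ℂ (Set.range (slaterVec e))).topologicalClosure := by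
  set K := (Submodule.span ℂ (Set.range (slaterVec e))).topologicalClosure
  have hKc : IsClosed (K : Set (FockSpace H)) := Submodule.isClosed_topologicalClosure _
  have : CompleteSpace K := hKc.completeSpace_coe
  obtain ⟨a, ha, c, hc, hac⟩ := K.exists_add_mem_mem_orthogonal u
  have haK : ∀ h, (∀ j, ⟪e j, h⟫_ℂ = 0) → annihilator h a = 0 := by
    intro h hh
    have h1 : K ≤ (annihilator h).ker := by
      refine Submodule.topologicalClosure_minimal _ ?_ (annihilator h).isClosed_ker
      rw [Submodule.span_le]
      rintro _ ⟨s, rfl⟩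
      exact annihilator_wedgeVec_of_orthogonal hh _
    exact h1 ha
  have hc0 : c = 0 := by
    refine eq_zero_of_inner_slaterVec he (fun h hh => ?_) fun s => ?_
    · rw [← add_sub_cancel_left a c, ← hac, map_sub, hu h hh, haK h hh, sub_zero]
    · exact hc _ (Submodule.le_topologicalClosure _ (Submodule.subset_span ⟨s, rfl⟩))
  rw [hac, hc0, add_zero]
  exact ha

/-- Parseval holds although the determinants need not be complete: `u` lies in their closed span, so
the additional members of an extended basis contribute nothing. -/
theorem tsum_enorm_inner_slaterVec (he : Orthonormal ℂ e) {u : FockSpace H}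
    (hu : ∀ h, (∀ j, ⟪e j, h⟫_ℂ = 0) → annihilator h u = 0) :
    ∑' s, ‖⟪slaterVec e s, u⟫_ℂ‖ₑ ^ 2 = ‖u‖ₑ ^ 2 := by
  obtain ⟨κ', ψ, hψ⟩ := exists_hilbertBasis_extension (orthonormal_slaterVec he)
  have hr : ∀ i, ⟪ψ (Sum.inr i), u⟫_ℂ = 0 := by
    intro i
    have h1 : (Submodule.span ℂ (Set.range (slaterVec e))).topologicalClosure ≤
        (Submodule.span ℂ {ψ (Sum.inr i)})ᗮ := by
      refine Submodule.topologicalClosure_minimal _ ?_ (Submodule.isClosed_orthogonal _)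
      rw [Submodule.span_le]
      rintro _ ⟨s, rfl⟩
      rw [← hψ]
      exact Submodule.mem_orthogonal_singleton_iff_inner_right.mpr
        (ψ.orthonormal.2 (by simp))
    exact Submodule.mem_orthogonal_singleton_iff_inner_right.mp
      (h1 (mem_closure_span_slaterVec he hu))
  rw [← tsum_enorm_inner_sq ψ, ← Function.Injective.tsum_eq Sum.inl_injective]
  · simp only [hψ]
  · rintro (s | i) hs
    · exact ⟨s, rfl⟩
    · simp [hr] at hs

/-- `aⱼ u` and `a†ⱼ aⱼ u` have the same norm, and `a†ⱼ aⱼ` keeps exactly the determinants with `j ∈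
s`. Parseval then gives the probability that mode `j` is occupied. -/
theorem enorm_annihilator_sq (he : Orthonormal ℂ e) {u : FockSpace H}
    (hu : ∀ h, (∀ j, ⟪e j, h⟫_ℂ = 0) → annihilator h u = 0) (j : κ) :
    ‖annihilator (e j) u‖ₑ ^ 2 = ∑' s, if j ∈ s then ‖⟪slaterVec e s, u⟫_ℂ‖ₑ ^ 2 else 0 := by
  have h1 : ‖annihilator (e j) u‖ = ‖creator (e j) (annihilator (e j) u)‖ := by
    have h2 := norm_sq_annihilator_add_norm_sq_creator (e j) (annihilator (e j) u)
    rw [annihilator_self, he.1, norm_zero, zero_pow two_ne_zero, zero_add, one_pow, one_mul] at h2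
    exact ((pow_left_inj₀ (norm_nonneg _) (norm_nonneg _) two_ne_zero).mp h2).symm
  rw [← ofReal_norm, h1, ofReal_norm, ← tsum_enorm_inner_slaterVec he]
  · refine tsum_congr fun s => ?_
    rw [← inner_annihilator, ← inner_creator, occupation_slaterVec he]
    split_ifs <;> simp
  · intro h hh
    rw [annihilator_creator, annihilator_annihilator, hu h hh, inner_eq_zero_symm.mp (hh j)]
    simp

end Occupation

/-! ### The number operator in the Slater basis -/

section NumberOperator

variable {H : Type*} [NormedAddCommGroup H] [InnerProductSpace ℂ H]
variable {ι : Type*}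

theorem annihilator_eq_zero_of_orthogonal (b : HilbertBasis ι ℂ H) (u : FockSpace H) (h : H)
    (hh : ∀ j, ⟪b j, h⟫_ℂ = 0) : annihilator h u = 0 := by
  have h0 : h = 0 := by
    rw [← enorm_eq_zero, ← pow_eq_zero_iff two_ne_zero, ← tsum_enorm_inner_sq b]
    simp [hh]
  have := annihilator_smul 0 h
  rw [zero_smul, map_zero, zero_smul] at this
  rw [h0, this]
  rfl

variable [LinearOrder ι]

theorem hasSum_occupation_slaterVec (b : HilbertBasis ι ℂ H) (s : Finset ι) :
    HasSum (fun j => creator (b j) (annihilator (b j) (slaterVec b s)))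
      ((s.card : ℂ) • slaterVec b s) := by
  simp only [occupation_slaterVec b.orthonormal]
  have := hasSum_sum_of_ne_finset_zero (f := fun j => if j ∈ s then slaterVec b s else 0)
    (s := s) (L := .unconditional ι) fun j hj => if_neg hj
  simpa [Finset.sum_ite_mem, Nat.cast_smul_eq_nsmul] using this

theorem slaterVec_mem_domain (b : HilbertBasis ι ℂ H) (s : Finset ι) :
    slaterVec b s ∈ (numberOperator b).domain := (hasSum_occupation_slaterVec b s).summable

theorem numberOperator_slaterVec (b : HilbertBasis ι ℂ H) (s : Finset ι) :
    numberOperator b ⟨slaterVec b s, slaterVec_mem_domain b s⟩ = (s.card : ℂ) • slaterVec b s :=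
  (hasSum_occupation_slaterVec b s).tsum_eq

variable [CompleteSpace H]

/-- The orthonormal basis of Fock space that belongs to an orthonormal basis of the one-particle
space. -/
def slaterBasis (b : HilbertBasis ι ℂ H) : HilbertBasis (Finset ι) ℂ (FockSpace H) :=
  HilbertBasis.mkOfOrthogonalEqBot (orthonormal_slaterVec b.orthonormal) (by
    rw [eq_bot_iff]
    intro u hu
    exact eq_zero_of_inner_slaterVec b.orthonormal (annihilator_eq_zero_of_orthogonal b u)
      fun s => hu _ (Submodule.subset_span ⟨s, rfl⟩))

theorem slaterBasis_apply (b : HilbertBasis ι ℂ H) (s : Finset ι) :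
    slaterBasis b s = slaterVec b s := by
  rw [slaterBasis, HilbertBasis.coe_mkOfOrthogonalEqBot]

end NumberOperator

/-! ### The one-particle operator: existence, positivity, finite trace -/

section OneParticle

universe u

variable {H : Type*} [NormedAddCommGroup H] [InnerProductSpace ℂ H]
variable {κ : Type*} {φ : HilbertBasis κ ℂ (FockSpace H)} {D : FockSpace H →L[ℂ] FockSpace H}
  {x : κ → ℝ}

theorem IsDensityOperator.exists_isEigenbasis {E : Type u} [NormedAddCommGroup E]
    [InnerProductSpace ℂ E] [CompleteSpace E] {D : E →L[ℂ] E} (hD : IsDensityOperator D) :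
    ∃ (κ : Type u) (φ : HilbertBasis κ ℂ E) (x : κ → ℝ), IsEigenbasis φ D x ∧ (∀ k, 0 ≤ x k) ∧
      HasSum x 1 := by
  have h1 : ∑' u, ENNReal.ofReal (⟪onb E u, D (onb E u)⟫_ℂ).re = 1 := hD.posTrace_eq
  obtain ⟨κ, φ, x, hφ⟩ := Fermion.exists_isEigenbasis hD.isPositive (onb E) (by simp [h1])
  have h0 := hφ.nonneg hD.isPositive
  refine ⟨κ, φ, x, hφ, h0, ?_⟩
  have h2 : ∑' k, ENNReal.ofReal (x k) = 1 := (hφ.posTrace_eq h0).symm.trans hD.posTrace_eq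
  have h3 : Summable x := by
    have := ENNReal.summable_toReal (f := fun k => ENNReal.ofReal (x k)) (by simp [h2])
    simpa only [ENNReal.toReal_ofReal (h0 _)] using this
  rw [← ENNReal.ofReal_tsum_of_nonneg h0 h3, ENNReal.ofReal_eq_one] at h2
  exact h2 ▸ h3.hasSum

theorem summable_mul_inner_annihilator (hx : Summable x) (h0 : ∀ k, 0 ≤ x k) (g h : H) :
    Summable fun k => (x k : ℂ) * ⟪annihilator h (φ k), annihilator g (φ k)⟫_ℂ := by
  refine Summable.of_norm_bounded (hx.mul_right (‖h‖ * ‖g‖)) fun k => ?_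
  rw [norm_mul, Complex.norm_of_nonneg (h0 k)]
  refine mul_le_mul_of_nonneg_left ((norm_inner_le_norm _ _).trans ?_) (h0 k)
  have h1 : ∀ h : H, ‖annihilator h (φ k)‖ ≤ ‖h‖ := fun h => by
    have := (annihilator h).le_of_opNorm_le (norm_annihilator_le h) (φ k)
    rwa [φ.orthonormal.1, mul_one] at this
  gcongr
  exacts [h1 h, h1 g]

-- The form is bounded by `(∑ x k) ‖g‖ ‖h‖`, since `‖a_h‖ ≤ ‖h‖`; the Riesz representation supplies
-- the operator.
variable (φ) in
theorem exists_oneParticleOperator [CompleteSpace H] (hx : Summable x) (h0 : ∀ k, 0 ≤ x k) :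
    ∃ G : H →L[ℂ] H, ∀ g h, ⟪h, G g⟫_ℂ =
      ∑' k, (x k : ℂ) * ⟪annihilator g (φ k), annihilator h (φ k)⟫_ℂ := by
  have hs := fun g h => summable_mul_inner_annihilator (φ := φ) hx h0 g h
  -- This is the conjugate of the required form, because the Riesz operator is characterised by `⟪G
  -- g, h⟫`.
  let f : H →ₗ⋆[ℂ] H →ₗ[ℂ] ℂ := LinearMap.mk₂'ₛₗ (starRingEnd ℂ) (RingHom.id ℂ)
    (fun g h => ∑' k, (x k : ℂ) * ⟪annihilator h (φ k), annihilator g (φ k)⟫_ℂ)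
    (fun g g' h => by
      rw [← (hs g h).tsum_add (hs g' h)]
      refine tsum_congr fun k => ?_
      rw [annihilator_add, add_apply, inner_add_right, mul_add])
    (fun c g h => by
      rw [smul_eq_mul, ← tsum_mul_left]
      refine tsum_congr fun k => ?_
      rw [annihilator_smul, smul_apply, inner_smul_right]
      ring)
    (fun g h h' => by
      rw [← (hs g h).tsum_add (hs g h')]
      refine tsum_congr fun k => ?_
      rw [annihilator_add, add_apply, inner_add_left, mul_add])
    (fun c g h => by
      rw [smul_eq_mul, ← tsum_mul_left]
      refine tsum_congr fun k => ?_
      rw [annihilator_smul, smul_apply, inner_smul_left]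
      simp
      ring)
  have hb : ∀ g h, ‖f g h‖ ≤ (∑' k, x k) * ‖g‖ * ‖h‖ := by
    intro g h
    have h1 : ∀ h k, ‖annihilator h (φ k)‖ ≤ ‖h‖ := fun h k => by
      have := (annihilator h).le_of_opNorm_le (norm_annihilator_le h) (φ k)
      rwa [φ.orthonormal.1, mul_one] at this
    rw [mul_assoc, ← tsum_mul_right]
    refine tsum_of_norm_bounded (hx.mul_right _).hasSum fun k => ?_
    rw [norm_mul, Complex.norm_of_nonneg (h0 k)]
    refine mul_le_mul_of_nonneg_left ((norm_inner_le_norm _ _).trans ?_) (h0 k)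
    rw [mul_comm]
    gcongr
    exacts [h1 g k, h1 h k]
  let B : H →L⋆[ℂ] H →L[ℂ] ℂ := f.mkContinuous₂ _ hb
  refine ⟨InnerProductSpace.continuousLinearMapOfBilin B, fun g h => ?_⟩
  rw [← inner_conj_symm, InnerProductSpace.continuousLinearMapOfBilin_apply]
  change starRingEnd ℂ (∑' k, (x k : ℂ) * ⟪annihilator h (φ k), annihilator g (φ k)⟫_ℂ) = _
  rw [Complex.conj_tsum]
  refine tsum_congr fun k => ?_
  rw [map_mul, inner_conj_symm, Complex.conj_ofReal]

variable [CompleteSpace H]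

theorem IsEigenbasis.inner_oneParticleOperator (hφ : IsEigenbasis φ D x) (hx : Summable x)
    (h0 : ∀ k, 0 ≤ x k) (g h : H) : ⟪h, oneParticleOperator D g⟫_ℂ =
      ∑' k, (x k : ℂ) * ⟪annihilator g (φ k), annihilator h (φ k)⟫_ℂ := by
  have htr : ∀ g h, trace (D * (creator g * annihilator h)) =
      ∑' k, (x k : ℂ) * ⟪annihilator g (φ k), annihilator h (φ k)⟫_ℂ := by
    intro g h
    rw [← (hφ.hasSum_trace hx h0 _).tsum_eq]
    refine tsum_congr fun k => ?_
    rw [mul_apply_eq_comp, inner_annihilator]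
  have hex : ∃ G : H →L[ℂ] H, ∀ g h : H,
      ⟪h, G g⟫_ℂ = trace (D * (creator g * annihilator h)) := by
    obtain ⟨G, hG⟩ := exists_oneParticleOperator φ hx h0
    exact ⟨G, fun g h => (hG g h).trans (htr g h).symm⟩
  rw [← htr, oneParticleOperator, dif_pos hex]
  exact hex.choose_spec g h

theorem IsEigenbasis.hasSum_oneParticleOperator (hφ : IsEigenbasis φ D x) (hx : Summable x)
    (h0 : ∀ k, 0 ≤ x k) (h : H) :
    HasSum (fun k => x k * ‖annihilator h (φ k)‖ ^ 2) (⟪h, oneParticleOperator D h⟫_ℂ).re ∧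
      (⟪h, oneParticleOperator D h⟫_ℂ).im = 0 := by
  have h1 := (summable_mul_inner_annihilator (φ := φ) hx h0 h h).hasSum
  rw [← hφ.inner_oneParticleOperator hx h0] at h1
  have h2 : ∀ k, (x k : ℂ) * ⟪annihilator h (φ k), annihilator h (φ k)⟫_ℂ =
      ((x k * ‖annihilator h (φ k)‖ ^ 2 : ℝ) : ℂ) := by
    intro k
    rw [inner_self_eq_norm_sq_to_K]
    push_cast
    rfl
  simp only [h2] at h1
  refine ⟨Complex.hasSum_re h1, ?_⟩
  have := Complex.hasSum_im h1
  simp only [Complex.ofReal_im] at this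
  exact this.unique hasSum_zero

theorem IsEigenbasis.ofReal_inner_oneParticleOperator (hφ : IsEigenbasis φ D x) (hx : Summable x)
    (h0 : ∀ k, 0 ≤ x k) (h : H) : ENNReal.ofReal (⟪h, oneParticleOperator D h⟫_ℂ).re =
      ∑' k, ENNReal.ofReal (x k) * ‖annihilator h (φ k)‖ₑ ^ 2 := by
  have h1 := (hφ.hasSum_oneParticleOperator hx h0 h).1
  rw [← h1.tsum_eq, ENNReal.ofReal_tsum_of_nonneg
    (fun k => mul_nonneg (h0 k) (by positivity)) h1.summable]
  exact tsum_congr fun k => by rw [ENNReal.ofReal_mul (h0 k), ofReal_sq_norm]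

theorem IsEigenbasis.isPositive_oneParticleOperator (hφ : IsEigenbasis φ D x) (hx : Summable x)
    (h0 : ∀ k, 0 ≤ x k) : (oneParticleOperator D).IsPositive := by
  rw [ContinuousLinearMap.isPositive_iff_complex]
  intro h
  obtain ⟨h1, h2⟩ := hφ.hasSum_oneParticleOperator hx h0 h
  have h3 : 0 ≤ (⟪h, oneParticleOperator D h⟫_ℂ).re := h1.nonneg fun k =>
    mul_nonneg (h0 k) (by positivity)
  have h4 := Complex.conj_eq_iff_im.mpr h2
  rw [inner_conj_symm] at h4
  have h5 := Complex.conj_eq_iff_re.mp (Complex.conj_eq_iff_im.mpr h2)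
  rw [h4]
  exact ⟨h5, h3⟩

/-- Both `Tr γ` and `Tr T` equal `∑ₖ xₖ ∑ₛ |s| |⟨a†ₛ Ω, φₖ⟩|²`: the former by counting occupied
modes, the latter because determinants are eigenvectors of `N` with eigenvalue `|s|`. -/
theorem IsEigenbasis.tsum_inner_oneParticleOperator {ι : Type*} {b : HilbertBasis ι ℂ H}
    (hD : InClassD b D) (hφ : IsEigenbasis φ D x) (hx : Summable x) (h0 : ∀ k, 0 ≤ x k) :
    ∑' j, ENNReal.ofReal (⟪b j, oneParticleOperator D (b j)⟫_ℂ).re ≠ ⊤ := by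
  classical
  let _ : LinearOrder ι := linearOrderOfSTO WellOrderingRel
  obtain ⟨T, hT, hfin, hTD⟩ := hD.finite_mean
  obtain ⟨κ', θ, t, hθ⟩ := exists_isEigenbasis hT (onb (FockSpace H)) hfin.ne
  have ht := hθ.nonneg hT
  have h1 : ∀ s, ENNReal.ofReal (⟪slaterBasis b s, T (slaterBasis b s)⟫_ℂ).re =
      ∑' k, ENNReal.ofReal (x k) * (s.card * ‖⟪slaterVec b s, φ k⟫_ℂ‖ₑ ^ 2) := by
    intro s
    rw [slaterBasis_apply, hTD ⟨_, slaterVec_mem_domain b s⟩, numberOperator_slaterVec, map_smul,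
      inner_smul_right]
    have h2 : ((s.card : ℂ) * ⟪slaterVec b s, D (slaterVec b s)⟫_ℂ).re =
        s.card * (⟪slaterVec b s, D (slaterVec b s)⟫_ℂ).re := by
      simp
    rw [h2, ENNReal.ofReal_mul (Nat.cast_nonneg _), hφ.ofReal_re_inner h0, ENNReal.ofReal_natCast,
      ← ENNReal.tsum_mul_left]
    refine tsum_congr fun k => ?_
    rw [enorm_inner_symm]
    ring
  have h3 : ∑' j, ENNReal.ofReal (⟪b j, oneParticleOperator D (b j)⟫_ℂ).re = posTrace T := by
    rw [hθ.posTrace_eq ht, ← hθ.tsum_diag ht (slaterBasis b)]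
    simp only [h1, hφ.ofReal_inner_oneParticleOperator hx h0]
    rw [ENNReal.tsum_comm, ENNReal.tsum_comm (α := Finset ι)]
    refine tsum_congr fun k => ?_
    rw [ENNReal.tsum_mul_left, ENNReal.tsum_mul_left]
    congr 1
    simp only [enorm_annihilator_sq b.orthonormal (annihilator_eq_zero_of_orthogonal b (φ k))]
    rw [ENNReal.tsum_comm]
    refine tsum_congr fun s => ?_
    rw [tsum_eq_sum (s := s) fun j hj => if_neg hj, Finset.sum_congr rfl fun j hj => if_pos hj,
      Finset.sum_const, nsmul_eq_mul]
  rw [h3]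
  exact hfin.ne

/-- An operator with an eigenbasis whose eigenvalues are nonnegative and summable has a list of
positive eigenvalues. -/
theorem IsEigenbasis.nonempty_eigenList {E : Type*} [NormedAddCommGroup E] [InnerProductSpace ℂ E]
    {κ : Type*} {ψ : HilbertBasis κ ℂ E} {G : E →L[ℂ] E} {g : κ → ℝ}
    (hψ : IsEigenbasis ψ G g) (h0 : ∀ k, 0 ≤ g k) (hg : Summable g) : Nonempty (EigenList G) := by
  -- A summable family has countable support, which permits indexing the positive eigenvalues by
  -- natural numbers.
  have hc : Countable {k // 0 < g k} := by
    refine (hg.countable_support.mono ?_).to_subtype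
    exact fun k hk => ne_of_gt hk
  obtain ⟨f, hf⟩ := exists_injective_nat {k // 0 < g k}
  let eq := Equiv.ofInjective f hf
  refine ⟨⟨Set.range f, fun j => ψ (eq.symm j), fun j => g (eq.symm j), ?_, fun j => hψ _,
    fun j => (eq.symm j).2, fun u hu => ?_⟩⟩
  · exact ψ.orthonormal.comp _ (Subtype.val_injective.comp eq.symm.injective)
  · refine (hψ.hasSum_apply u).unique ?_
    convert hasSum_zero using 2 with k
    rcases (h0 k).eq_or_lt with hk | hk
    · simp [← hk]
    · have := hu (eq ⟨k, hk⟩)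
      rw [Equiv.symm_apply_apply] at this
      simp [this]

end OneParticle

/-! ### Cross entropy relative to a product distribution -/

section FreeState

variable {K J : Type*} {X : K → ENNReal} {c : K → Finset J → ENNReal}

open Classical in
/-- The cross entropy of a distribution of finite sets relative to a product distribution with the
same marginals. -/
theorem tsum_neg_log_bernoulliWeight {p : J → ℝ} (hp : Summable p) (h0 : ∀ j, 0 < p j)
    (h1 : ∀ j, p j ≤ 1)
    (hin : ∀ j, ∑' k, X k * ∑' s, (if j ∈ s then c k s else 0) = ENNReal.ofReal (p j))
    (hout : ∀ j, ∑' k, X k * ∑' s, (if j ∈ s then 0 else c k s) = ENNReal.ofReal (1 - p j)) :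
    ∑' k, ∑' s, X k * c k s * ENNReal.ofReal (-Real.log (bernoulliWeight p s)) =
      ∑' j, ENNReal.ofReal (-(p j * Real.log (p j))) +
        ∑' j, ENNReal.ofReal (-((1 - p j) * Real.log (1 - p j))) := by
  have hterm : ∀ k s, X k * c k s * ENNReal.ofReal (-Real.log (bernoulliWeight p s)) =
      ∑' j, ((X k * if j ∈ s then c k s else 0) * ENNReal.ofReal (-Real.log (p j)) +
        (X k * if j ∈ s then 0 else c k s) * ENNReal.ofReal (-Real.log (1 - p j))) := by
    intro k s
    have hsplit : ∀ j, (X k * if j ∈ s then c k s else 0) * ENNReal.ofReal (-Real.log (p j)) +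
        (X k * if j ∈ s then 0 else c k s) * ENNReal.ofReal (-Real.log (1 - p j)) =
        X k * c k s * if j ∈ s then ENNReal.ofReal (-Real.log (p j)) else
          ENNReal.ofReal (-Real.log (1 - p j)) := by
      intro j
      split_ifs <;> simp
    rw [tsum_congr hsplit, ENNReal.tsum_mul_left]
    by_cases hs : ∀ j ∉ s, p j < 1
    · rw [ofReal_neg_log_bernoulliWeight hp h0 h1 hs]
    -- Here `p j = 1` for some `j ∉ s`. By `hout`, such an `s` carries no mass, so the value of `log
    -- 0` is immaterial.
    · push Not at hs
      obtain ⟨j, hjs, hj⟩ := hs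
      have h2 := hout j
      rw [le_antisymm (h1 j) hj, sub_self, ENNReal.ofReal_zero, ENNReal.tsum_eq_zero] at h2
      have h3 : X k * c k s = 0 := by
        have h4 := h2 k
        rw [← ENNReal.tsum_mul_left, ENNReal.tsum_eq_zero] at h4
        simpa [hjs] using h4 s
      rw [h3, zero_mul, zero_mul]
  simp only [hterm]
  have hswap : ∀ f : K → Finset J → J → ENNReal,
      ∑' k, ∑' s, ∑' j, f k s j = ∑' j, ∑' k, ∑' s, f k s j := fun f => by
    rw [ENNReal.tsum_comm (α := J)]
    exact tsum_congr fun k => ENNReal.tsum_comm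
  rw [hswap, ← ENNReal.tsum_add]
  refine tsum_congr fun j => ?_
  simp only [ENNReal.tsum_add, ENNReal.tsum_mul_right, ENNReal.tsum_mul_left, hin, hout]
  rw [← ENNReal.ofReal_mul (h0 j).le, ← ENNReal.ofReal_mul (sub_nonneg.mpr (h1 j)), mul_neg,
    mul_neg]

/-- The real identity is a rearrangement; the point is that every summand is nonnegative, so
`ENNReal.ofReal` loses nothing. For the relative entropy term this is `log t ≤ t - 1` at `t = w /
x`. The hypothesis `h` removes the case `w = 0` when `x` and `c` are nonzero. -/
theorem relative_entropy_term {c : ENNReal} {x w : ℝ} (hx0 : 0 ≤ x) (hx1 : x ≤ 1) (hw0 : 0 ≤ w)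
    (hw1 : w ≤ 1) (h : w = 0 → ENNReal.ofReal x * c = 0) :
    c * ENNReal.ofReal (x * Real.log x - x * Real.log w + w - x) +
        c * ENNReal.ofReal (Real.negMulLog x) + ENNReal.ofReal x * c =
      ENNReal.ofReal x * c * ENNReal.ofReal (-Real.log w) + c * ENNReal.ofReal w := by
  rcases hx0.eq_or_lt with rfl | hx
  · simp
  by_cases hc : c = 0
  · simp [hc]
  have hw : 0 < w := by
    refine hw0.lt_of_ne' fun hw => ?_
    rcases mul_eq_zero.mp (h hw) with h1 | h1
    · exact hx.not_ge (ENNReal.ofReal_eq_zero.mp h1)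
    · exact hc h1
  have hlog : 0 ≤ x * Real.log x - x * Real.log w + w - x := by
    have h1 := Real.log_le_sub_one_of_pos (div_pos hw hx)
    rw [Real.log_div hw.ne' hx.ne'] at h1
    have h2 := mul_le_mul_of_nonneg_left h1 hx.le
    have h3 : x * (w / x - 1) = w - x := by field_simp
    rw [h3] at h2
    linarith
  have hn : 0 ≤ -Real.log w := neg_nonneg.mpr (Real.log_nonpos hw0 hw1)
  rw [mul_comm (ENNReal.ofReal x), mul_assoc, ← ENNReal.ofReal_mul hx0, ← mul_add, ← mul_add,
    ← mul_add, ← ENNReal.ofReal_add hlog (Real.negMulLog_nonneg hx0 hx1),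
    ← ENNReal.ofReal_add (add_nonneg hlog (Real.negMulLog_nonneg hx0 hx1)) hx0,
    ← ENNReal.ofReal_add (mul_nonneg hx0 hn) hw0]
  congr 2
  rw [Real.negMulLog]
  ring

end FreeState

/-! ### Overlaps of the eigenvectors with the Slater determinants, and the sum rule -/

section Nonfreeness

variable {H : Type*} [NormedAddCommGroup H] [InnerProductSpace ℂ H]

theorem EigenList.inner_vec {G : H →L[ℂ] H} (L : EigenList G) (j : L.index) :
    (⟪L.vec j, G (L.vec j)⟫_ℂ).re = L.val j := by
  rw [L.eigen, inner_smul_right, inner_self_eq_norm_sq_to_K, L.orthonormal.1]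
  simp

/-- The defining series converges in operator norm: the rank-one projectors have norm `1` and the
weights are summable. -/
theorem EigenList.freeDensity_apply {G : H →L[ℂ] H} (L : EigenList G) (hp : Summable L.val)
    (h1 : ∀ j, L.val j ≤ 1) (u : FockSpace H) : HasSum (fun s => ((bernoulliWeight L.val s : ℂ) *
      ⟪slaterVec L.vec s, u⟫_ℂ) • slaterVec L.vec s) (L.freeDensity u) := by
  have hn : ∀ s, ‖slaterVec L.vec s‖ = 1 := (orthonormal_slaterVec L.orthonormal).1
  have hw := bernoulliWeight_nonneg hp (fun j => (L.pos j).le) h1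
  have hs : Summable fun s : Finset L.index => (bernoulliWeight L.val s : ℂ) •
      InnerProductSpace.rankOne ℂ (slaterVec L.vec s) (slaterVec L.vec s) := by
    refine Summable.of_norm_bounded
      (hasSum_bernoulliWeight hp (fun j => (L.pos j).le) h1).summable fun s => ?_
    rw [norm_smul, Complex.norm_of_nonneg (hw s), InnerProductSpace.norm_rankOne, hn]
    simp
  have := hs.hasSum.mapL (ContinuousLinearMap.apply ℂ _ u)
  simp only [ContinuousLinearMap.apply_apply, smul_apply, InnerProductSpace.rankOne_apply,
    smul_smul] at this
  exact this

theorem EigenList.isEigenbasis_freeDensity {G : H →L[ℂ] H} (L : EigenList G)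
    (hp : Summable L.val) (h1 : ∀ j, L.val j ≤ 1) {κ' : Type*}
    {ψ : HilbertBasis (Finset L.index ⊕ κ') ℂ (FockSpace H)}
    (hψ : ∀ s, ψ (Sum.inl s) = slaterVec L.vec s) :
    IsEigenbasis ψ L.freeDensity (Sum.elim (bernoulliWeight L.val) 0) := by
  classical
  intro i
  refine (L.freeDensity_apply hp h1 (ψ i)).unique ?_
  simp only [← hψ, orthonormal_iff_ite.mp ψ.orthonormal]
  rcases i with s | i
  · refine (congrArg (HasSum · _) (funext fun t => ?_)).mpr (hasSum_ite_eq s _)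
    by_cases hts : t = s
    · subst hts
      simp
    · simp [hts]
  · simp [hasSum_zero]

variable [CompleteSpace H]
variable {κ : Type*} {φ : HilbertBasis κ ℂ (FockSpace H)} {D : FockSpace H →L[ℂ] FockSpace H}
  {x : κ → ℝ}

/-- Extend the listed eigenvectors to an orthonormal basis. Their eigenvalues are then part of the
trace, which is finite. -/
theorem EigenList.summable_val {G : H →L[ℂ] H} (L : EigenList G) {ι : Type*}
    {ψ : HilbertBasis ι ℂ H} {g : ι → ℝ} (hψ : IsEigenbasis ψ G g) (h0 : ∀ i, 0 ≤ g i)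
    (hg : Summable g) : Summable L.val := by
  obtain ⟨κ', θ, hθ⟩ := exists_hilbertBasis_extension L.orthonormal
  have h1 : ∑' j, ENNReal.ofReal (L.val j) ≤ ∑' i, ENNReal.ofReal (g i) := by
    rw [← hψ.tsum_diag h0 θ]
    refine le_trans (le_of_eq (tsum_congr fun j => ?_)) (ENNReal.tsum_comp_le_tsum_of_injective
      Sum.inl_injective fun u => ENNReal.ofReal (⟪θ u, G (θ u)⟫_ℂ).re)
    rw [hθ, L.eigen, inner_smul_right, inner_self_eq_norm_sq_to_K, L.orthonormal.1]
    simp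
  have h2 := ENNReal.summable_toReal (ne_top_of_le_ne_top hg.tsum_ofReal_ne_top h1)
  simpa only [ENNReal.toReal_ofReal (L.pos _).le] using h2

variable (L : EigenList (oneParticleOperator D))

/-- The eigenvectors of the density operator are annihilated by all `a_h` with `h` orthogonal to the
eigenvectors of the one-particle operator. -/
theorem IsEigenbasis.annihilator_eq_zero (hφ : IsEigenbasis φ D x) (hx : Summable x)
    (h0 : ∀ k, 0 ≤ x k) {k : κ} (hk : 0 < x k) (h : H) (hh : ∀ j, ⟪L.vec j, h⟫_ℂ = 0) :
    annihilator h (φ k) = 0 := by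
  have h1 := hφ.ofReal_inner_oneParticleOperator hx h0 h
  rw [L.complete h hh, inner_zero_right, Complex.zero_re, ENNReal.ofReal_zero, eq_comm,
    ENNReal.tsum_eq_zero] at h1
  rcases mul_eq_zero.mp (h1 k) with h2 | h2
  · exact absurd (ENNReal.ofReal_eq_zero.mp h2) hk.not_ge
  · exact enorm_eq_zero.mp (pow_eq_zero_iff two_ne_zero |>.mp h2)

theorem IsEigenbasis.tsum_overlap (hφ : IsEigenbasis φ D x) (hx : Summable x)
    (h0 : ∀ k, 0 ≤ x k) {k : κ} (hk : 0 < x k) :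
    ∑' s, ‖⟪φ k, slaterVec L.vec s⟫_ℂ‖ₑ ^ 2 = 1 := by
  simp only [enorm_inner_symm (φ k)]
  rw [tsum_enorm_inner_slaterVec L.orthonormal (hφ.annihilator_eq_zero L hx h0 hk), ← ofReal_norm,
    φ.orthonormal.1]
  simp

/-- The marginals agree: the probability that mode `j` is occupied is the expectation of `a†ⱼ aⱼ`,
that is `⟨fⱼ|γ fⱼ⟩`. -/
theorem IsEigenbasis.tsum_overlap_mem (hφ : IsEigenbasis φ D x) (hx : Summable x)
    (h0 : ∀ k, 0 ≤ x k) (j : L.index) :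
    ∑' k, ENNReal.ofReal (x k) * ∑' s, (if j ∈ s then ‖⟪φ k, slaterVec L.vec s⟫_ℂ‖ₑ ^ 2 else 0) =
      ENNReal.ofReal (L.val j) := by
  rw [← L.inner_vec, hφ.ofReal_inner_oneParticleOperator hx h0]
  refine tsum_congr fun k => ?_
  rcases (h0 k).eq_or_lt with hk | hk
  · simp [← hk]
  · rw [enorm_annihilator_sq L.orthonormal (hφ.annihilator_eq_zero L hx h0 hk)]
    simp only [enorm_inner_symm (φ k)]
    congr! 4

theorem IsEigenbasis.tsum_overlap_add (hφ : IsEigenbasis φ D x) (hx : HasSum x 1)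
    (h0 : ∀ k, 0 ≤ x k) (j : L.index) :
    ENNReal.ofReal (L.val j) + ∑' k, ENNReal.ofReal (x k) *
      ∑' s, (if j ∈ s then 0 else ‖⟪φ k, slaterVec L.vec s⟫_ℂ‖ₑ ^ 2) = 1 := by
  rw [← hφ.tsum_overlap_mem L hx.summable h0, ← ENNReal.tsum_add, ← ENNReal.ofReal_one,
    ← hx.tsum_eq, ENNReal.ofReal_tsum_of_nonneg h0 hx.summable]
  refine tsum_congr fun k => ?_
  rcases (h0 k).eq_or_lt with hk | hk
  · simp [← hk]
  · rw [← mul_add, ← ENNReal.tsum_add]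
    refine Eq.trans ?_ (mul_one _)
    rw [← hφ.tsum_overlap L hx.summable h0 hk]
    congr 1
    refine tsum_congr fun s => ?_
    split_ifs <;> simp

theorem IsEigenbasis.val_le_one (hφ : IsEigenbasis φ D x) (hx : HasSum x 1)
    (h0 : ∀ k, 0 ≤ x k) (j : L.index) : L.val j ≤ 1 := by
  rw [← ENNReal.ofReal_le_one, ← hφ.tsum_overlap_add L hx h0 j]
  exact le_self_add

theorem IsEigenbasis.tsum_overlap_notMem (hφ : IsEigenbasis φ D x) (hx : HasSum x 1)
    (h0 : ∀ k, 0 ≤ x k) (j : L.index) :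
    ∑' k, ENNReal.ofReal (x k) * ∑' s, (if j ∈ s then 0 else ‖⟪φ k, slaterVec L.vec s⟫_ℂ‖ₑ ^ 2) =
      ENNReal.ofReal (1 - L.val j) := by
  have h1 := hφ.tsum_overlap_add L hx h0 j
  rw [ENNReal.ofReal_sub _ (L.pos j).le, ENNReal.ofReal_one, ← h1,
    ENNReal.add_sub_cancel_left ENNReal.ofReal_ne_top]

/-- A zero weight forces `pⱼ = 1` for some `j ∉ s`; the probability `1 - pⱼ` of missing `j` is then
zero, and `s` is one of the sets that miss `j`. -/
theorem IsEigenbasis.overlap_eq_zero (hφ : IsEigenbasis φ D x) (hx : HasSum x 1)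
    (h0 : ∀ k, 0 ≤ x k) (hp : Summable L.val) (k : κ) {s : Finset L.index}
    (hs : bernoulliWeight L.val s = 0) :
    ENNReal.ofReal (x k) * ‖⟪φ k, slaterVec L.vec s⟫_ℂ‖ₑ ^ 2 = 0 := by
  have h1 : ¬ ∀ j ∉ s, L.val j < 1 := fun h => (bernoulliWeight_pos hp L.pos h).ne' hs
  push Not at h1
  obtain ⟨j, hjs, hj⟩ := h1
  have h2 := hφ.tsum_overlap_notMem L hx h0 j
  rw [le_antisymm (hφ.val_le_one L hx h0 j) hj, sub_self, ENNReal.ofReal_zero,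
    ENNReal.tsum_eq_zero] at h2
  have h4 := h2 k
  rw [← ENNReal.tsum_mul_left, ENNReal.tsum_eq_zero] at h4
  simpa [hjs] using h4 s

/-- The nonfreeness and the entropy add up to the entropy of the free state. -/
theorem IsEigenbasis.nonfreeness_add_entropy (hφ : IsEigenbasis φ D x) (hD : D.IsPositive)
    (hx : HasSum x 1) (h0 : ∀ k, 0 ≤ x k) (hp : Summable L.val) :
    nonfreeness D L + entropy D = L.freeEntropy := by
  obtain ⟨κ', ψ, hψ⟩ := exists_hilbertBasis_extension (orthonormal_slaterVec L.orthonormal)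
  have h1 := hφ.val_le_one L hx h0
  have hp0 : ∀ j, 0 ≤ L.val j := fun j => (L.pos j).le
  have hw0 := bernoulliWeight_nonneg hp hp0 h1
  have hw := hasSum_bernoulliWeight hp hp0 h1
  have hΓ := L.isEigenbasis_freeDensity hp h1 hψ
  have hx1 : ∀ k, x k ≤ 1 := fun k => (hx.summable.le_tsum k fun i _ => h0 i).trans_eq hx.tsum_eq
  have hw1 : ∀ s, bernoulliWeight L.val s ≤ 1 := fun s =>
    (hw.summable.le_tsum s fun i _ => hw0 i).trans_eq hw.tsum_eq
  -- The overlaps with the determinants already exhaust the norm `1` of `φ k`, leaving nothing for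
  -- the rest of the basis.
  have hr : ∀ k, 0 < x k → ∀ i, ⟪φ k, ψ (Sum.inr i)⟫_ℂ = 0 := by
    intro k hk i
    have h2 := tsum_enorm_inner_sq' ψ (φ k)
    rw [(HasSum.sum ENNReal.summable.hasSum ENNReal.summable.hasSum).tsum_eq,
      ← ofReal_norm, φ.orthonormal.1, ENNReal.ofReal_one, one_pow] at h2
    simp only [Function.comp_def, hψ, hφ.tsum_overlap L hx.summable h0 hk] at h2
    have h3 := (ENNReal.add_right_inj ENNReal.one_ne_top).mp (h2.trans (add_zero 1).symm)
    simpa using ENNReal.tsum_eq_zero.mp h3 i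
  have hker : L.freeDensity.ker ≤ D.ker := by
    intro u hu
    rw [LinearMap.mem_ker] at hu ⊢
    have hu' : ∀ i, ((Sum.elim (bernoulliWeight L.val) 0 i : ℝ) : ℂ) * ⟪ψ i, u⟫_ℂ = 0 := by
      intro i
      rw [← hΓ.inner_apply i u]
      exact (congrArg _ hu).trans (inner_zero_right _)
    refine (hφ.hasSum_apply u).unique ?_
    convert hasSum_zero using 2 with k
    rcases (h0 k).eq_or_lt with hk | hk
    · simp [← hk]
    have h2 : ⟪φ k, u⟫_ℂ = 0 := by
      rw [← ψ.tsum_inner_mul_inner]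
      refine (tsum_congr fun i => ?_).trans tsum_zero
      rcases i with s | i
      · rcases mul_eq_zero.mp (hu' (Sum.inl s)) with h2 | h2
        · have h3 := hφ.overlap_eq_zero L hx h0 hp k (by exact_mod_cast h2)
          rw [mul_eq_zero, ENNReal.ofReal_eq_zero, pow_eq_zero_iff two_ne_zero, enorm_eq_zero] at h3
          rw [hψ, h3.resolve_left hk.not_ge, zero_mul]
        · rw [h2, mul_zero]
      · rw [hr k hk, zero_mul]
    rw [h2, mul_zero, zero_smul]
  have hrel : nonfreeness D L = ∑' k, ∑' s, ‖⟪φ k, slaterVec L.vec s⟫_ℂ‖ₑ ^ 2 *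
      ENNReal.ofReal (x k * Real.log (x k) - x k * Real.log (bernoulliWeight L.val s) +
        bernoulliWeight L.val s - x k) := by
    rw [nonfreeness, hφ.relEntropy_eq hΓ hker]
    refine tsum_congr fun k => ?_
    rw [← Function.Injective.tsum_eq Sum.inl_injective]
    · simp only [hψ, Sum.elim_inl]
    · rintro (s | i) hs
      · exact ⟨s, rfl⟩
      · rcases (h0 k).eq_or_lt with hk | hk
        · simp [← hk] at hs
        · simp [hr k hk] at hs
  have hent : entropy D = ∑' k, ∑' s, ‖⟪φ k, slaterVec L.vec s⟫_ℂ‖ₑ ^ 2 *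
      ENNReal.ofReal (Real.negMulLog (x k)) := by
    rw [hφ.entropy_eq hD.isSelfAdjoint h0 hx1]
    refine tsum_congr fun k => ?_
    rcases (h0 k).eq_or_lt with hk | hk
    · simp [← hk]
    · rw [ENNReal.tsum_mul_right, hφ.tsum_overlap L hx.summable h0 hk, one_mul]
  -- The summands `+ y - x` of the relative entropy need the total masses of `Δ` and of `Γ`. Both
  -- are `1`; they are added to the two sides and cancelled.
  have hone : (1 : ENNReal) = ∑' k, ∑' s,
      ENNReal.ofReal (x k) * ‖⟪φ k, slaterVec L.vec s⟫_ℂ‖ₑ ^ 2 := by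
    rw [← ENNReal.ofReal_one, ← hx.tsum_eq, ENNReal.ofReal_tsum_of_nonneg h0 hx.summable]
    refine tsum_congr fun k => ?_
    rcases (h0 k).eq_or_lt with hk | hk
    · simp [← hk]
    · rw [ENNReal.tsum_mul_left, hφ.tsum_overlap L hx.summable h0 hk, mul_one]
  have hone' : ∑' k, ∑' s, ‖⟪φ k, slaterVec L.vec s⟫_ℂ‖ₑ ^ 2 *
      ENNReal.ofReal (bernoulliWeight L.val s) = 1 := by
    rw [ENNReal.tsum_comm, ← ENNReal.ofReal_one, ← hw.tsum_eq,
      ENNReal.ofReal_tsum_of_nonneg hw0 hw.summable]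
    refine tsum_congr fun s => ?_
    rw [ENNReal.tsum_mul_right, tsum_enorm_inner_sq, ← ofReal_norm,
      (orthonormal_slaterVec L.orthonormal).1]
    simp
  have hfree : ∑' k, ∑' s, ENNReal.ofReal (x k) * ‖⟪φ k, slaterVec L.vec s⟫_ℂ‖ₑ ^ 2 *
      ENNReal.ofReal (-Real.log (bernoulliWeight L.val s)) = L.freeEntropy := by
    refine tsum_neg_log_bernoulliWeight hp L.pos h1 (fun j => ?_) fun j => ?_
    · convert hφ.tsum_overlap_mem L hx.summable h0 j
    · convert hφ.tsum_overlap_notMem L hx h0 j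
  refine (ENNReal.add_left_inj ENNReal.one_ne_top).mp ?_
  conv_lhs => rw [hone]
  rw [← hone', ← hfree, hrel, hent]
  simp only [← ENNReal.tsum_add]
  exact tsum_congr fun k => tsum_congr fun s => relative_entropy_term (h0 k) (hx1 k) (hw0 s)
    (hw1 s) fun hs => hφ.overlap_eq_zero L hx h0 hp k hs

end Nonfreeness

end Fermion

end

theorem proposition1 {H : Type*} [NormedAddCommGroup H] [InnerProductSpace ℂ H] [CompleteSpace H]
    {ι : Type*} (b : HilbertBasis ι ℂ H)
    (D : Fermion.FockSpace H →L[ℂ] Fermion.FockSpace H) (hD : Fermion.InClassD b D) :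
    Nonempty (Fermion.EigenList (Fermion.oneParticleOperator D)) ∧
      ∀ L : Fermion.EigenList (Fermion.oneParticleOperator D), L.freeEntropy < ⊤ →
        ((Fermion.nonfreeness D L : ENNReal) : EReal) =
          ((L.freeEntropy : ENNReal) : EReal) - ((Fermion.entropy D : ENNReal) : EReal) := by
  obtain ⟨κ, φ, x, hφ, h0, hx⟩ := hD.isDensityOperator.exists_isEigenbasis
  have hG := hφ.isPositive_oneParticleOperator hx.summable h0
  have htr := hφ.tsum_inner_oneParticleOperator hD hx.summable h0
  obtain ⟨κ', ψ, g, hψ⟩ := Fermion.exists_isEigenbasis hG b htr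
  have hg0 := hψ.nonneg hG
  have hg : Summable g := by
    rw [hψ.tsum_diag hg0] at htr
    simpa only [ENNReal.toReal_ofReal (hg0 _)] using ENNReal.summable_toReal htr
  refine ⟨hψ.nonempty_eigenList hg0 hg, fun L hL => ?_⟩
  have key := hφ.nonfreeness_add_entropy L hD.isDensityOperator.isPositive hx h0
    (L.summable_val hψ hg0 hg)
  -- The sum rule bounds the entropy by the free entropy, so it is finite and may be subtracted in
  -- `EReal`.
  have hfin : Fermion.entropy D ≠ ⊤ :=
    ne_top_of_le_ne_top hL.ne (key ▸ le_add_self)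
  rw [← key, EReal.coe_ennreal_add]
  lift Fermion.entropy D to NNReal using hfin with t
  exact (EReal.add_sub_cancel_right (a := ((Fermion.nonfreeness D L : ENNReal) : EReal))
    (b := (t : ℝ))).symm
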